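/- All manifolds and tensors are smooth; $M$ need not be compact. On a Riemannian $4$-manifold $(M,g)$ with Ricci tensor $r$ and scalar curvature $s$, write $[B]_0=B-\tfrac14(\operatorname{tr}_gB)\,g$ for the trace-free part of a bilinear form, $(\alpha\circ\beta)_{jk}=\alpha_j{}^{\ell}\beta_{\ell k}$ for $2$-forms $\alpha,\beta$, and, given an orientation, $F^\pm=\tfrac12(F\pm\star F)$ for the self-dual and anti-self-dual parts of a $2$-form $F$. (a) On any oriented Riemannian $4$-manifold, every $2$-form $F$ satisfies $[F\circ F]_0=2\,F^+\circ F^-$. (b) Let $(M^4,g,J)$ be Kähler (that is, $J$ is an integrable almost-complex structure, $g$ is $J$-invariant, and $\omega=g(J\cdot,\cdot)$ is closed), oriented by $J$, and suppose that $s$ is constant. Then $\omega=g(J\cdot,\cdot)$ and $\rho=r(J\cdot,\cdot)$ are $2$-forms, and with $\mathring\rho=\rho-\tfrac s4\omega$ and $$F=\omega+\tfrac12\mathring\rho,$$ $F$ is smooth, $F^+=\omega$ and $F^-=\tfrac12\mathring\rho$, and $F$ is harmonic in the sense that $dF=0$ and $d\star F=0$. Moreover $(g,F)$ solves the Einstein–Maxwell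 equations $$dF=0,\qquad d\star F=0,\qquad [\,r+F\circ F\,]_0=0 .$$ -/

import Mathlib

set_option maxSynthPendingDepth 3

open scoped Manifold ContDiff Bundle Topology
open Module Bundle

noncomputable section

/-! ## Linear algebra on an oriented Euclidean 4-space -/

section Pointwise

variable {V : Type*} [NormedAddCommGroup V] [InnerProductSpace ℝ V]

/-- The alternating 2-form `(v, w) ↦ (B(v, w) - B(w, v)) / 2`.
For a skew-symmetric `B` this is `B` itself, regarded as a 2-form. -/
def skewForm (B : V →L[ℝ] V →L[ℝ] ℝ) : V [⋀^Fin 2]→L[ℝ] ℝ where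
  toFun v := (B (v 0) (v 1) - B (v 1) (v 0)) / 2
  map_update_add' := by
    intro _ m i x y
    fin_cases i <;> simp [Function.update] <;> ring
  map_update_smul' := by
    intro _ m i c x
    fin_cases i <;> simp [Function.update] <;> ring
  map_eq_zero_of_eq' := by
    intro v i j h hij
    fin_cases i <;> fin_cases j <;> simp_all
  cont := by
    fun_prop

variable [FiniteDimensional ℝ V]

/-- Trace of a bilinear form with respect to the inner product. -/
def metricTrace (B : V → V → ℝ) : ℝ :=
  ∑ i, B (stdOrthonormalBasis ℝ V i) (stdOrthonormalBasis ℝ V i)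

/-- Trace-free part `[B]₀ = B - (tr B / dim V) g` of a bilinear form. -/
def traceFree (B : V → V → ℝ) : V → V → ℝ :=
  fun v w => B v w - metricTrace B / (finrank ℝ V : ℝ) * inner ℝ v w

/-- `(α ∘ β)_{jk} = α_j{}^l β_{lk}`. -/
def formComp (α β : V [⋀^Fin 2]→L[ℝ] ℝ) : V → V → ℝ :=
  fun v w => ∑ l, α ![v, stdOrthonormalBasis ℝ V l] * β ![stdOrthonormalBasis ℝ V l, w]

variable [Fact (finrank ℝ V = 4)]

/-- The volume form of an oriented Euclidean 4-space, as a continuous alternating form. -/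
def volForm (o : Orientation ℝ V (Fin 4)) : V [⋀^Fin 4]→L[ℝ] ℝ :=
  o.volumeForm.mkContinuous 1 (fun v => by simpa using o.abs_volumeForm_apply_le v)

/-- Hodge star of a 2-form: `(⋆α)_{kl} = (1/2) α^{ij} vol_{ijkl}`. -/
def hodgeStar (o : Orientation ℝ V (Fin 4)) (α : V [⋀^Fin 2]→L[ℝ] ℝ) : V [⋀^Fin 2]→L[ℝ] ℝ :=
  (1 / 2 : ℝ) • ∑ i, ∑ j, α ![stdOrthonormalBasis ℝ V i, stdOrthonormalBasis ℝ V j] •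
    ((volForm o).curryLeft (stdOrthonormalBasis ℝ V i)).curryLeft (stdOrthonormalBasis ℝ V j)

/-- Self-dual part of a 2-form. -/
def selfDualPart (o : Orientation ℝ V (Fin 4)) (α : V [⋀^Fin 2]→L[ℝ] ℝ) : V [⋀^Fin 2]→L[ℝ] ℝ :=
  (1 / 2 : ℝ) • (α + hodgeStar o α)

/-- Anti-self-dual part of a 2-form. -/
def antiSelfDualPart (o : Orientation ℝ V (Fin 4)) (α : V [⋀^Fin 2]→L[ℝ] ℝ) :
    V [⋀^Fin 2]→L[ℝ] ℝ :=
  (1 / 2 : ℝ) • (α - hodgeStar o α)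

end Pointwise

section ComplexOrientation

/-- If `J² = -1` on a real vector space, all bases `(v, Jv, w, Jw)` have the same orientation. -/
theorem exists_complexOrientation {V : Type*} [AddCommGroup V] [Module ℝ V] (J : V →ₗ[ℝ] V)
    (hJ : ∀ v, J (J v) = -v) (hV : finrank ℝ V = 4) :
    ∃ o : Orientation ℝ V (Fin 4), ∀ b : Basis (Fin 4) ℝ V,
      b 1 = J (b 0) → b 3 = J (b 2) → b.orientation = o := by
  by_cases h : ∃ b : Basis (Fin 4) ℝ V, b 1 = J (b 0) ∧ b 3 = J (b 2)
  · obtain ⟨b, h1, h3⟩ := h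
    refine ⟨b.orientation, fun c k1 k3 => ?_⟩
    symm
    rw [Basis.orientation_eq_iff_det_pos]
    have e1 : J (b 1) = -b 0 := by rw [h1, hJ]
    have e3 : J (b 3) = -b 2 := by rw [h3, hJ]
    have key : ∀ v : V, b.repr (J v) 0 = -b.repr v 1 ∧ b.repr (J v) 1 = b.repr v 0 ∧
        b.repr (J v) 2 = -b.repr v 3 ∧ b.repr (J v) 3 = b.repr v 2 := by
      intro v
      have hv := b.sum_repr v
      rw [Fin.sum_univ_four] at hv
      have hJv : J v = b.repr v 0 • b 1 - b.repr v 1 • b 0 + b.repr v 2 • b 3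
          - b.repr v 3 • b 2 := by
        conv_lhs => rw [← hv]
        simp only [map_add, map_smul, ← h1, ← h3, e1, e3]
        module
      rw [hJv]
      simp
    have hne : b.det c ≠ 0 := (b.isUnit_det c).ne_zero
    refine lt_of_le_of_ne ?_ hne.symm
    obtain ⟨p0, p1, p2, p3⟩ := key (c 0)
    obtain ⟨q0, q1, q2, q3⟩ := key (c 2)
    rw [Basis.det_apply, Matrix.det_succ_row_zero]
    simp [Fin.sum_univ_succ, Matrix.det_fin_three, Basis.toMatrix_apply, Fin.succAbove, k1, k3,
      p0, p1, p2, p3, q0, q1, q2, q3]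
    have sq := add_nonneg
      (sq_nonneg (b.repr (c 0) 0 * b.repr (c 2) 2 - b.repr (c 0) 1 * b.repr (c 2) 3
        - b.repr (c 0) 2 * b.repr (c 2) 0 + b.repr (c 0) 3 * b.repr (c 2) 1))
      (sq_nonneg (b.repr (c 0) 0 * b.repr (c 2) 3 + b.repr (c 0) 1 * b.repr (c 2) 2
        - b.repr (c 0) 2 * b.repr (c 2) 1 - b.repr (c 0) 3 * b.repr (c 2) 0))
    linarith [sq]
  · have : Module.Finite ℝ V := Module.finite_of_finrank_pos (by omega)
    exact ⟨(finBasisOfFinrankEq ℝ V hV).orientation, fun b h1 h3 => absurd ⟨b, h1, h3⟩ h⟩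

end ComplexOrientation

/-! ## Curvature of a metric on (an open subset of) a vector space -/

section Local

set_option linter.unusedSectionVars false

variable {E : Type*} [NormedAddCommGroup E] [NormedSpace ℝ E] [FiniteDimensional ℝ E]

/-- `K(u, v)(w) = (D_u h)(v, w) + (D_v h)(u, w) - (D_w h)(u, v)` for a metric `h`. -/
def localKoszul (h : E → E →L[ℝ] E →L[ℝ] ℝ) (y : E) : E →L[ℝ] E →L[ℝ] E →L[ℝ] ℝ :=
  fderiv ℝ h y + (fderiv ℝ h y).flip -
    ((ContinuousLinearMap.flipₗᵢ ℝ E E ℝ).toLinearIsometry.toContinuousLinearMap ∘L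
      (fderiv ℝ h y).flip : E →L[ℝ] E →L[ℝ] E →L[ℝ] ℝ)

theorem localKoszul_apply (h : E → E →L[ℝ] E →L[ℝ] ℝ) (y u v w : E) :
    localKoszul h y u v w =
      fderiv ℝ h y u v w + fderiv ℝ h y v u w - fderiv ℝ h y w u v := rfl

/-- Christoffel map `Γ` of a metric `h`: `h(Γ(u, v), w) = K(u, v)(w) / 2`, that is,
`Γᵏᵢⱼ = hᵏˡ (∂ᵢ hⱼₗ + ∂ⱼ hᵢₗ - ∂ₗ hᵢⱼ) / 2`. -/
def localChristoffel (h : E → E →L[ℝ] E →L[ℝ] ℝ) (y : E) : E →L[ℝ] E →L[ℝ] E :=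
  (1 / 2 : ℝ) • (ContinuousLinearMap.compL ℝ E (E →L[ℝ] ℝ) E (h y).inverse ∘L localKoszul h y)

theorem localChristoffel_apply (h : E → E →L[ℝ] E →L[ℝ] ℝ) (y u v : E) :
    localChristoffel h y u v = (1 / 2 : ℝ) • (h y).inverse (localKoszul h y u v) := rfl

/-- Riemann curvature `R(u, v)w = ∇_u ∇_v w - ∇_v ∇_u w` for constant fields `u`, `v`, `w`. -/
def localRiemann (h : E → E →L[ℝ] E →L[ℝ] ℝ) (y : E) : E →L[ℝ] E →L[ℝ] E →L[ℝ] E :=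
  fderiv ℝ (localChristoffel h) y - (fderiv ℝ (localChristoffel h) y).flip +
    (ContinuousLinearMap.compL ℝ E E E).bilinearComp (localChristoffel h y)
      (localChristoffel h y) -
    ((ContinuousLinearMap.compL ℝ E E E).bilinearComp (localChristoffel h y)
      (localChristoffel h y)).flip

theorem localRiemann_apply (h : E → E →L[ℝ] E →L[ℝ] ℝ) (y u v w : E) :
    localRiemann h y u v w =
      fderiv ℝ (localChristoffel h) y u v w - fderiv ℝ (localChristoffel h) y v u w +
        localChristoffel h y u (localChristoffel h y v w) -
        localChristoffel h y v (localChristoffel h y u w) := rfl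

/-- The trace as a continuous linear functional on endomorphisms. -/
def traceCLM (E : Type*) [NormedAddCommGroup E] [NormedSpace ℝ E] [FiniteDimensional ℝ E] :
    (E →L[ℝ] E) →L[ℝ] ℝ :=
  LinearMap.toContinuousLinearMap (LinearMap.trace ℝ E ∘ₗ ContinuousLinearMap.coeLM ℝ)

/-- Ricci curvature `Ric(v, w) = tr (u ↦ R(u, v)w)`. -/
def localRicci (h : E → E →L[ℝ] E →L[ℝ] ℝ) (y : E) : E →L[ℝ] E →L[ℝ] ℝ :=
  ContinuousLinearMap.compL ℝ E (E →L[ℝ] E) ℝ (traceCLM E) ∘L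
    (ContinuousLinearMap.flipₗᵢ ℝ E E E).toLinearIsometry.toContinuousLinearMap ∘L
      (localRiemann h y).flip

theorem localRicci_apply (h : E → E →L[ℝ] E →L[ℝ] ℝ) (y v w : E) :
    localRicci h y v w =
      LinearMap.trace ℝ E (((localRiemann h y).flip v).flip w : E →L[ℝ] E) := rfl

end Local

/-! ## Riemannian 4-manifolds -/

section Manifold

abbrev E4 : Type := EuclideanSpace ℝ (Fin 4)

variable {M : Type*} [TopologicalSpace M] [ChartedSpace E4 M]

/-- The derivative at `y` of the inverse of the preferred chart around `p`. -/
def chartSymmDeriv (p : M) (y : E4) :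
    E4 →L[ℝ] TangentSpace (𝓡 4) ((extChartAt (𝓡 4) p).symm y) :=
  mfderiv 𝓘(ℝ, E4) (𝓡 4) (extChartAt (𝓡 4) p).symm y

/-- The derivative at `x` of the preferred chart around `x`. -/
def chartDeriv (x : M) : TangentSpace (𝓡 4) x →L[ℝ] E4 :=
  mfderiv (𝓡 4) 𝓘(ℝ, E4) (extChartAt (𝓡 4) x) x

/-- A differential `k`-form on `M`, expressed in the preferred chart around `p`. -/
def formInChart {k : ℕ} (α : ∀ x : M, TangentSpace (𝓡 4) x [⋀^Fin k]→L[ℝ] ℝ) (p : M) (y : E4) :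
    E4 [⋀^Fin k]→L[ℝ] ℝ :=
  (α ((extChartAt (𝓡 4) p).symm y)).compContinuousLinearMap (chartSymmDeriv p y)

/-- A differential form is smooth if it is so in local coordinates. -/
def IsSmoothForm {k : ℕ} (α : ∀ x : M, TangentSpace (𝓡 4) x [⋀^Fin k]→L[ℝ] ℝ) : Prop :=
  ∀ p : M, ContDiffOn ℝ ∞ (formInChart α p) (extChartAt (𝓡 4) p).target

/-- Exterior derivative of a differential form on `M`, computed in local coordinates. -/
def dForm {k : ℕ} (α : ∀ x : M, TangentSpace (𝓡 4) x [⋀^Fin k]→L[ℝ] ℝ) (x : M) :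
    TangentSpace (𝓡 4) x [⋀^Fin (k + 1)]→L[ℝ] ℝ :=
  (extDeriv (formInChart α x) (extChartAt (𝓡 4) x x)).compContinuousLinearMap (chartDeriv x)

instance (x : M) : FiniteDimensional ℝ (TangentSpace (𝓡 4) x) :=
  inferInstanceAs (FiniteDimensional ℝ E4)

instance (x : M) : Fact (finrank ℝ (TangentSpace (𝓡 4) x) = 4) :=
  ⟨finrank_euclideanSpace_fin (𝕜 := ℝ) (n := 4)⟩

variable [RiemannianBundle (fun x : M => TangentSpace (𝓡 4) x)]

/-- The metric tensor in the preferred chart around `p`. -/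
def metricInChart (p : M) (y : E4) : E4 →L[ℝ] E4 →L[ℝ] ℝ :=
  (innerSL ℝ (E := TangentSpace (𝓡 4) ((extChartAt (𝓡 4) p).symm y))).bilinearComp
    (chartSymmDeriv p y) (chartSymmDeriv p y)

/-- The Ricci tensor `r` of the metric. -/
def ricci (x : M) : TangentSpace (𝓡 4) x →L[ℝ] TangentSpace (𝓡 4) x →L[ℝ] ℝ :=
  (localRicci (metricInChart x) (extChartAt (𝓡 4) x x)).bilinearComp (chartDeriv x) (chartDeriv x)

/-- The scalar curvature `s`, the metric trace of `r`. -/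
def scalarCurvature (x : M) : ℝ :=
  metricTrace fun v w : TangentSpace (𝓡 4) x => ricci x v w

/-- The 2-form `ω = g(J·, ·)`. -/
def kahlerForm (J : ∀ x : M, TangentSpace (𝓡 4) x →L[ℝ] TangentSpace (𝓡 4) x) (x : M) :
    TangentSpace (𝓡 4) x [⋀^Fin 2]→L[ℝ] ℝ :=
  skewForm (innerSL ℝ ∘L J x)

/-- The Ricci form `ρ = r(J·, ·)`. -/
def ricciForm (J : ∀ x : M, TangentSpace (𝓡 4) x →L[ℝ] TangentSpace (𝓡 4) x) (x : M) :
    TangentSpace (𝓡 4) x [⋀^Fin 2]→L[ℝ] ℝ :=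
  skewForm (ricci x ∘L J x)

/-- The primitive part `ρ - (s / 4) ω` of the Ricci form. -/
def primitiveRicciForm (J : ∀ x : M, TangentSpace (𝓡 4) x →L[ℝ] TangentSpace (𝓡 4) x) (x : M) :
    TangentSpace (𝓡 4) x [⋀^Fin 2]→L[ℝ] ℝ :=
  ricciForm J x - (scalarCurvature x / 4) • kahlerForm J x

variable [IsManifold (𝓡 4) ∞ M]

/-- `(g, J)` is a Kähler structure: `J` is a smooth integrable almost-complex structure (its
Nijenhuis tensor vanishes), `g` is `J`-invariant, and the 2-form `ω = g(J·, ·)` is closed. -/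
structure IsKahler (J : ∀ x : M, TangentSpace (𝓡 4) x →L[ℝ] TangentSpace (𝓡 4) x) : Prop where
  smooth : ContMDiff (𝓡 4) ((𝓡 4).prod 𝓘(ℝ, E4 →L[ℝ] E4)) ∞
    fun x : M => TotalSpace.mk' (E4 →L[ℝ] E4)
      (E := fun x : M => TangentSpace (𝓡 4) x →L[ℝ] TangentSpace (𝓡 4) x) x (J x)
  sq_eq_neg : ∀ (x : M) (v : TangentSpace (𝓡 4) x), J x (J x v) = -v
  integrable : ∀ (X Y : ∀ y : M, TangentSpace (𝓡 4) y) (x : M),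
    ContMDiffAt (𝓡 4) ((𝓡 4).prod 𝓘(ℝ, E4)) ∞ (fun y => (⟨y, X y⟩ : TangentBundle (𝓡 4) M)) x →
    ContMDiffAt (𝓡 4) ((𝓡 4).prod 𝓘(ℝ, E4)) ∞ (fun y => (⟨y, Y y⟩ : TangentBundle (𝓡 4) M)) x →
    VectorField.mlieBracket (𝓡 4) (fun y => J y (X y)) (fun y => J y (Y y)) x
      - J x (VectorField.mlieBracket (𝓡 4) (fun y => J y (X y)) Y x)
      - J x (VectorField.mlieBracket (𝓡 4) X (fun y => J y (Y y)) x)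
      - VectorField.mlieBracket (𝓡 4) X Y x = 0
  hermitian : ∀ (x : M) (v w : TangentSpace (𝓡 4) x), inner ℝ (J x v) (J x w) = inner ℝ v w
  closed : ∀ x : M, dForm (kahlerForm J) x = 0

/-- The orientation of a Kähler surface determined by its complex structure: bases of the form
`(v, Jv, w, Jw)` are positively oriented. -/
def IsKahler.orientation
    {J : ∀ x : M, TangentSpace (𝓡 4) x →L[ℝ] TangentSpace (𝓡 4) x} (hJ : IsKahler J) (x : M) :
    Orientation ℝ (TangentSpace (𝓡 4) x) (Fin 4) :=
  (exists_complexOrientation (J x).toLinearMap (hJ.sq_eq_neg x) Fact.out).choose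

theorem IsKahler.orientation_eq
    {J : ∀ x : M, TangentSpace (𝓡 4) x →L[ℝ] TangentSpace (𝓡 4) x} (hJ : IsKahler J) (x : M)
    (b : Basis (Fin 4) ℝ (TangentSpace (𝓡 4) x)) (h1 : b 1 = J x (b 0)) (h3 : b 3 = J x (b 2)) :
    b.orientation = hJ.orientation x :=
  (exists_complexOrientation (J x).toLinearMap (hJ.sq_eq_neg x) Fact.out).choose_spec b h1 h3

/-- `F` is a smooth solution of Maxwell's equations `dF = 0`, `d⋆F = 0`, i.e. a smooth 2-form that
is closed and co-closed. -/
structure IsMaxwell (o : ∀ x : M, Orientation ℝ (TangentSpace (𝓡 4) x) (Fin 4))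
    (F : ∀ x : M, TangentSpace (𝓡 4) x [⋀^Fin 2]→L[ℝ] ℝ) : Prop where
  smooth : IsSmoothForm F
  closed : ∀ x : M, dForm F x = 0
  coclosed : ∀ x : M, dForm (fun y => hodgeStar (o y) (F y)) x = 0

/-- `(g, F)` solves the Einstein-Maxwell equations `dF = 0`, `d⋆F = 0`, `[r + F ∘ F]₀ = 0`. -/
structure IsEinsteinMaxwell (o : ∀ x : M, Orientation ℝ (TangentSpace (𝓡 4) x) (Fin 4))
    (F : ∀ x : M, TangentSpace (𝓡 4) x [⋀^Fin 2]→L[ℝ] ℝ) : Prop where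
  maxwell : IsMaxwell o F
  einstein : ∀ (x : M) (v w : TangentSpace (𝓡 4) x),
    traceFree (fun v w => ricci x v w + formComp (F x) (F x) v w) v w = 0

end Manifold

end

/-! Part (a) is algebra at a point. In an oriented orthonormal basis `⋆` permutes the six components
of a 2-form up to sign, and the claim becomes a polynomial identity in these components
(`traceFree_formComp_self`).

For (b), a unitary basis `(e, Je, f, Jf)` shows that `ω` is self-dual and, since the Ricci tensor is
symmetric and `J`-invariant, that `ρ₀ = ρ - (s/4)ω` is anti-self-dual. Hence `F = ω + ρ₀/2` has the
stated parts, `⋆F = ω - ρ₀/2`, and by (a) `[F ∘ F]₀ = ω ∘ ρ₀ = -[r]₀`, because composing with `ω`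
inserts `J` and `J² = -1`. When `s` is constant, `F` and `⋆F` are combinations of `ω` and `ρ` with
constant coefficients, so Maxwell's equations reduce to `dω = 0` and `dρ = 0`.

The closedness of `ρ` is local. `dω = 0` and the vanishing of the Nijenhuis tensor force `∇J = 0`
(`IsKahlerOn.parallel`), so `J` commutes with the curvature (`complex_riemann`). Pair symmetry then
makes the Ricci tensor `J`-invariant (`ricci_complex`), and the first Bianchi identity gives `2ρ(u,
v) = tr (J R(u, v))` (`ricci_complex_skew`). The second Bianchi identity together with `∇J = 0`
shows that this trace is closed (`ricci_closed`).

The Ricci tensor and `d` at a point are defined through the preferred chart of that point, while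
differentiation needs one chart on an open set. Transition maps are local isometries, under which
Ricci tensors correspond (`IsLocalIsometryOn.ricci_eq`, `ricci_chartSymmDeriv`), and `d` commutes
with pullback (`extDeriv_formInChart_eq_zero`). -/

noncomputable section

/-! ## 2-forms on an oriented Euclidean 4-space -/

section TwoForms

set_option linter.unusedSectionVars false

variable {V : Type*} [NormedAddCommGroup V] [InnerProductSpace ℝ V]

/-- A 2-form as a bilinear map. -/
def twoFormBilin (α : V [⋀^Fin 2]→L[ℝ] ℝ) : V →ₗ[ℝ] V →ₗ[ℝ] ℝ :=
  LinearMap.mk₂ ℝ (fun v w => α ![v, w])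
    (fun v v' w => α.toAlternatingMap.map_vecCons_add ![w] v v')
    (fun c v w => α.toAlternatingMap.map_vecCons_smul ![w] c v)
    (fun v w w' => (α.toAlternatingMap.curryLeft v).map_vecCons_add ![] w w')
    (fun c v w => (α.toAlternatingMap.curryLeft v).map_vecCons_smul ![] c w)

theorem twoFormBilin_apply (α : V [⋀^Fin 2]→L[ℝ] ℝ) (v w : V) :
    twoFormBilin α v w = α ![v, w] := rfl

theorem twoForm_self (α : V [⋀^Fin 2]→L[ℝ] ℝ) (v : V) : α ![v, v] = 0 :=
  α.map_eq_zero_of_eq ![v, v] (i := 0) (j := 1) rfl (by simp)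

theorem twoForm_swap (α : V [⋀^Fin 2]→L[ℝ] ℝ) (v w : V) : α ![v, w] = -α ![w, v] := by
  have h := twoForm_self α (v + w)
  rw [← twoFormBilin_apply] at h
  simp only [map_add, LinearMap.add_apply, twoFormBilin_apply, twoForm_self] at h
  linarith

theorem twoForm_eta (α : V [⋀^Fin 2]→L[ℝ] ℝ) (v : Fin 2 → V) : α v = α ![v 0, v 1] := by
  congr 1
  ext i
  fin_cases i <;> rfl

theorem twoForm_ext {α β : V [⋀^Fin 2]→L[ℝ] ℝ} (h : ∀ v w, α ![v, w] = β ![v, w]) : α = β := by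
  ext v
  rw [twoForm_eta α, twoForm_eta β, h]

/-- A 2-form is determined by its values on increasing pairs of basis vectors. -/
theorem twoForm_ext_basis {α β : V [⋀^Fin 2]→L[ℝ] ℝ} (b : Basis (Fin 4) ℝ V)
    (h01 : α ![b 0, b 1] = β ![b 0, b 1]) (h02 : α ![b 0, b 2] = β ![b 0, b 2])
    (h03 : α ![b 0, b 3] = β ![b 0, b 3]) (h12 : α ![b 1, b 2] = β ![b 1, b 2])
    (h13 : α ![b 1, b 3] = β ![b 1, b 3]) (h23 : α ![b 2, b 3] = β ![b 2, b 3]) : α = β := by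
  have key : twoFormBilin α = twoFormBilin β := by
    refine LinearMap.ext_basis b b fun i j => ?_
    simp only [twoFormBilin_apply]
    fin_cases i <;> fin_cases j <;>
      simp only [Fin.zero_eta, Fin.mk_one, Fin.reduceFinMk, twoForm_self] <;>
      first
      | assumption
      | (rw [twoForm_swap α, twoForm_swap β, neg_inj]; assumption)
  exact twoForm_ext fun v w => by
    simpa only [twoFormBilin_apply] using congrArg (fun B => B v w) key

theorem skewForm_apply (B : V →L[ℝ] V →L[ℝ] ℝ) (v w : V) :
    skewForm B ![v, w] = (B v w - B w v) / 2 := rfl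

/-- The metric trace of a bilinear map can be computed in any orthonormal basis. -/
theorem sum_bilin_orthonormalBasis {ι κ : Type*} [Fintype ι] [Fintype κ]
    (b : OrthonormalBasis ι ℝ V) (e : OrthonormalBasis κ ℝ V) (B : V →ₗ[ℝ] V →ₗ[ℝ] ℝ) :
    ∑ l, B (e l) (e l) = ∑ i, B (b i) (b i) := by
  classical
  have h1 : ∀ l, B (e l) (e l) = ∑ i, inner ℝ (b i) (e l) * B (b i) (e l) := by
    intro l
    conv_lhs => enter [1]; rw [← b.sum_repr' (e l)]
    simp
  have h2 : ∀ i, B (b i) (b i) = ∑ l, inner ℝ (b i) (e l) * B (b i) (e l) := by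
    intro i
    conv_lhs => enter [2]; rw [← e.sum_repr' (b i)]
    simp [real_inner_comm]
  simp only [h1, h2]
  rw [Finset.sum_comm]

variable [FiniteDimensional ℝ V]

theorem metricTrace_eq {ι : Type*} [Fintype ι] (b : OrthonormalBasis ι ℝ V)
    (B : V →ₗ[ℝ] V →ₗ[ℝ] ℝ) :
    metricTrace (fun v w => B v w) = ∑ i, B (b i) (b i) :=
  sum_bilin_orthonormalBasis b (stdOrthonormalBasis ℝ V) B

theorem formComp_eq {ι : Type*} [Fintype ι] (b : OrthonormalBasis ι ℝ V)
    (α β : V [⋀^Fin 2]→L[ℝ] ℝ) (v w : V) :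
    formComp α β v w = ∑ i, α ![v, b i] * β ![b i, w] := by
  have := sum_bilin_orthonormalBasis b (stdOrthonormalBasis ℝ V)
    ((LinearMap.mul ℝ ℝ).compl₁₂ (twoFormBilin α v) ((twoFormBilin β).flip w))
  exact this

/-- The composition of 2-forms as a bilinear map. -/
def formCompBilin (α β : V [⋀^Fin 2]→L[ℝ] ℝ) : V →ₗ[ℝ] V →ₗ[ℝ] ℝ :=
  ∑ l, (LinearMap.mul ℝ ℝ).compl₁₂ ((twoFormBilin α).flip (stdOrthonormalBasis ℝ V l))
    (twoFormBilin β (stdOrthonormalBasis ℝ V l))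

theorem formCompBilin_apply (α β : V [⋀^Fin 2]→L[ℝ] ℝ) (v w : V) :
    formCompBilin α β v w = formComp α β v w := by
  simp only [formCompBilin, formComp, LinearMap.sum_apply, LinearMap.compl₁₂_apply,
    LinearMap.mul_apply', LinearMap.flip_apply, twoFormBilin_apply]

theorem traceFree_apply (B : V → V → ℝ) (v w : V) :
    traceFree B v w = B v w - metricTrace B / (finrank ℝ V : ℝ) * inner ℝ v w := rfl

theorem traceFree_add (A B : V → V → ℝ) (v w : V) :
    traceFree (fun v w => A v w + B v w) v w = traceFree A v w + traceFree B v w := by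
  simp only [traceFree, metricTrace, Finset.sum_add_distrib]
  ring

variable [Fact (finrank ℝ V = 4)]

theorem exists_orthonormalBasis_orientation (o : Orientation ℝ V (Fin 4)) :
    ∃ b : OrthonormalBasis (Fin 4) ℝ V, b.toBasis.orientation = o :=
  ⟨o.finOrthonormalBasis (by norm_num) Fact.out, o.finOrthonormalBasis_orientation _ _⟩

/-- The star is a contraction of two indices, so its independence of the orthonormal basis follows
by changing the basis in one index at a time. -/
theorem hodgeStar_apply (o : Orientation ℝ V (Fin 4)) (b : OrthonormalBasis (Fin 4) ℝ V)
    (α : V [⋀^Fin 2]→L[ℝ] ℝ) (v w : V) :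
    hodgeStar o α ![v, w] =
      (1 / 2 : ℝ) * ∑ i, ∑ j, α ![b i, b j] * o.volumeForm ![b i, b j, v, w] := by
  set e := stdOrthonormalBasis ℝ V
  let β (x y : V) : V [⋀^Fin 2]→L[ℝ] ℝ := ((volForm o).curryLeft x).curryLeft y
  have hβ : ∀ x y, β x y ![v, w] = o.volumeForm ![x, y, v, w] := fun x y => rfl
  let W : V →ₗ[ℝ] V →ₗ[ℝ] ℝ := LinearMap.mk₂ ℝ (fun x y => o.volumeForm ![x, y, v, w])
    (fun x x' y => o.volumeForm.map_vecCons_add _ _ _)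
    (fun c x y => o.volumeForm.map_vecCons_smul _ _ _)
    (fun x y y' => (o.volumeForm.curryLeft x).map_vecCons_add ![v, w] y y')
    (fun c x y => (o.volumeForm.curryLeft x).map_vecCons_smul ![v, w] c y)
  have h0 : hodgeStar o α ![v, w] =
      (1 / 2 : ℝ) * ∑ i, ∑ j, α ![e i, e j] * o.volumeForm ![e i, e j, v, w] := by
    simp only [hodgeStar, ContinuousAlternatingMap.smul_apply, ContinuousAlternatingMap.sum_apply,
      smul_eq_mul]
    rfl
  rw [h0]
  congr 1
  have h1 : ∀ i, ∑ j, α ![e i, e j] * o.volumeForm ![e i, e j, v, w] =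
      ∑ j, α ![e i, b j] * o.volumeForm ![e i, b j, v, w] := fun i =>
    sum_bilin_orthonormalBasis b e
      ((LinearMap.mul ℝ ℝ).compl₁₂ (twoFormBilin α (e i)) (W (e i)))
  rw [Finset.sum_congr rfl fun i _ => h1 i, Finset.sum_comm]
  conv_rhs => rw [Finset.sum_comm]
  refine Finset.sum_congr rfl fun j _ => ?_
  exact sum_bilin_orthonormalBasis b e
      ((LinearMap.mul ℝ ℝ).compl₁₂ ((twoFormBilin α).flip (b j)) (W.flip (b j)))

/-- The sign of the permutation with values `i, j, k, l`, and `0` if two of them are equal. -/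
def permSign (i j k l : Fin 4) : ℤ :=
  (Matrix.of fun m n => if m = ![i, j, k, l] n then (1 : ℤ) else 0).det

theorem volumeForm_orthonormalBasis (o : Orientation ℝ V (Fin 4))
    (b : OrthonormalBasis (Fin 4) ℝ V) (hb : b.toBasis.orientation = o) (i j k l : Fin 4) :
    o.volumeForm ![b i, b j, b k, b l] = permSign i j k l := by
  rw [o.volumeForm_robust b hb, Basis.det_apply, permSign, Int.cast_det]
  congr 1
  ext m n
  have : (![b i, b j, b k, b l] : Fin 4 → V) n = b (![i, j, k, l] n) := by fin_cases n <;> rfl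
  rw [Basis.toMatrix_apply, this]
  have := b.toBasis.repr_self_apply (![i, j, k, l] n) m
  rw [OrthonormalBasis.coe_toBasis] at this
  rw [this]
  simp [Matrix.map_apply, eq_comm]

/-- `permSign` is an integer determinant precisely so that this table can be decided by evaluation.
-/
theorem permSign_pairs (i j : Fin 4) :
    (permSign i j 0 1 = if i = 2 ∧ j = 3 then 1 else if i = 3 ∧ j = 2 then -1 else 0) ∧
    (permSign i j 0 2 = if i = 1 ∧ j = 3 then -1 else if i = 3 ∧ j = 1 then 1 else 0) ∧
    (permSign i j 0 3 = if i = 1 ∧ j = 2 then 1 else if i = 2 ∧ j = 1 then -1 else 0) ∧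
    (permSign i j 1 2 = if i = 0 ∧ j = 3 then 1 else if i = 3 ∧ j = 0 then -1 else 0) ∧
    (permSign i j 1 3 = if i = 0 ∧ j = 2 then -1 else if i = 2 ∧ j = 0 then 1 else 0) ∧
    (permSign i j 2 3 = if i = 0 ∧ j = 1 then 1 else if i = 1 ∧ j = 0 then -1 else 0) := by
  revert i j
  decide +kernel

theorem hodgeStar_orthonormalBasis (o : Orientation ℝ V (Fin 4))
    (b : OrthonormalBasis (Fin 4) ℝ V) (hb : b.toBasis.orientation = o)
    (α : V [⋀^Fin 2]→L[ℝ] ℝ) :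
    hodgeStar o α ![b 0, b 1] = α ![b 2, b 3] ∧ hodgeStar o α ![b 0, b 2] = -α ![b 1, b 3] ∧
    hodgeStar o α ![b 0, b 3] = α ![b 1, b 2] ∧ hodgeStar o α ![b 1, b 2] = α ![b 0, b 3] ∧
    hodgeStar o α ![b 1, b 3] = -α ![b 0, b 2] ∧ hodgeStar o α ![b 2, b 3] = α ![b 0, b 1] := by
  have s10 := twoForm_swap α (b 1) (b 0)
  have s20 := twoForm_swap α (b 2) (b 0)
  have s30 := twoForm_swap α (b 3) (b 0)
  have s21 := twoForm_swap α (b 2) (b 1)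
  have s31 := twoForm_swap α (b 3) (b 1)
  have s32 := twoForm_swap α (b 3) (b 2)
  refine ⟨?_, ?_, ?_, ?_, ?_, ?_⟩ <;>
  · simp only [hodgeStar_apply o b, volumeForm_orthonormalBasis o b hb, permSign_pairs,
      Fin.sum_univ_four]
    simp only [Fin.isValue, Fin.reduceEq, and_false, and_true, and_self, if_true, if_false,
      Int.cast_one, Int.cast_neg, Int.cast_zero, mul_zero, add_zero, zero_add, s10, s20, s30, s21,
      s31, s32]
    ring

end TwoForms

/-! ### Self-dual and anti-self-dual parts. -/

section SelfDuality

set_option linter.unusedSectionVars false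

variable {V : Type*} [NormedAddCommGroup V] [InnerProductSpace ℝ V] [FiniteDimensional ℝ V]
  [Fact (finrank ℝ V = 4)]

theorem selfDualPart_apply (o : Orientation ℝ V (Fin 4)) (α : V [⋀^Fin 2]→L[ℝ] ℝ) (v w : V) :
    selfDualPart o α ![v, w] = (1 / 2 : ℝ) * (α ![v, w] + hodgeStar o α ![v, w]) := rfl

theorem antiSelfDualPart_apply (o : Orientation ℝ V (Fin 4)) (α : V [⋀^Fin 2]→L[ℝ] ℝ)
    (v w : V) :
    antiSelfDualPart o α ![v, w] = (1 / 2 : ℝ) * (α ![v, w] - hodgeStar o α ![v, w]) := rfl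

theorem hodgeStar_add (o : Orientation ℝ V (Fin 4)) (α β : V [⋀^Fin 2]→L[ℝ] ℝ) :
    hodgeStar o (α + β) = hodgeStar o α + hodgeStar o β := by
  simp only [hodgeStar, ContinuousAlternatingMap.add_apply, add_smul, Finset.sum_add_distrib,
    smul_add]

theorem hodgeStar_smul (o : Orientation ℝ V (Fin 4)) (c : ℝ) (α : V [⋀^Fin 2]→L[ℝ] ℝ) :
    hodgeStar o (c • α) = c • hodgeStar o α := by
  simp only [hodgeStar, ContinuousAlternatingMap.smul_apply, smul_eq_mul, mul_smul,
    ← Finset.smul_sum]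
  rw [smul_comm]

/-- `[F ∘ F]₀ = 2 F⁺ ∘ F⁻`. -/
theorem traceFree_formComp_self (o : Orientation ℝ V (Fin 4)) (F : V [⋀^Fin 2]→L[ℝ] ℝ) (v w : V) :
    traceFree (formComp F F) v w
      = 2 * formComp (selfDualPart o F) (antiSelfDualPart o F) v w := by
  obtain ⟨b, hb⟩ := exists_orthonormalBasis_orientation o
  obtain ⟨h01, h02, h03, h12, h13, h23⟩ := hodgeStar_orthonormalBasis o b hb F
  have htr : metricTrace (formComp F F) = ∑ i, formComp F F (b i) (b i) := by
    have := metricTrace_eq b (formCompBilin F F)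
    simpa only [formCompBilin_apply] using this
  -- As an equality of bilinear maps, the claim needs checking only on the sixteen pairs of basis
  -- vectors, where both sides are quadratic polynomials in the components of `F`.
  have key : formCompBilin F F - (metricTrace (formComp F F) / (finrank ℝ V : ℝ)) • innerₗ V
      = (2 : ℝ) • formCompBilin (selfDualPart o F) (antiSelfDualPart o F) := by
    refine LinearMap.ext_basis b.toBasis b.toBasis fun i j => ?_
    have s10 := twoForm_swap F (b 1) (b 0)
    have s20 := twoForm_swap F (b 2) (b 0)
    have s30 := twoForm_swap F (b 3) (b 0)
    have s21 := twoForm_swap F (b 2) (b 1)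
    have s31 := twoForm_swap F (b 3) (b 1)
    have s32 := twoForm_swap F (b 3) (b 2)
    have t10 := twoForm_swap (hodgeStar o F) (b 1) (b 0)
    have t20 := twoForm_swap (hodgeStar o F) (b 2) (b 0)
    have t30 := twoForm_swap (hodgeStar o F) (b 3) (b 0)
    have t21 := twoForm_swap (hodgeStar o F) (b 2) (b 1)
    have t31 := twoForm_swap (hodgeStar o F) (b 3) (b 1)
    have t32 := twoForm_swap (hodgeStar o F) (b 3) (b 2)
    have hd : finrank ℝ V = 4 := Fact.out
    rw [h01] at t10
    rw [h02] at t20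
    rw [h03] at t30
    rw [h12] at t21
    rw [h13] at t31
    rw [h23] at t32
    rw [htr, hd]
    simp only [LinearMap.sub_apply, LinearMap.smul_apply, formCompBilin_apply, smul_eq_mul,
      OrthonormalBasis.coe_toBasis, innerₗ_apply_apply, b.inner_eq_ite, formComp_eq b,
      selfDualPart_apply, antiSelfDualPart_apply, Fin.sum_univ_four]
    fin_cases i <;> fin_cases j <;>
    · simp only [Fin.zero_eta, Fin.mk_one, Fin.reduceFinMk, Fin.isValue, Fin.reduceEq, if_true,
        if_false, twoForm_self, s10, s20, s30, s21, s31, s32, t10, t20, t30, t21, t31, t32,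
        h01, h02, h03, h12, h13, h23]
      push_cast
      ring
  have := congrArg (fun B => B v w) key
  simp only [LinearMap.sub_apply, LinearMap.smul_apply, formCompBilin_apply, smul_eq_mul,
    innerₗ_apply_apply] at this
  exact this

/-! ## Hermitian structures -/

variable {J : V →L[ℝ] V}

theorem inner_complex_left (hJ : ∀ v, J (J v) = -v)
    (hg : ∀ v w, inner ℝ (J v) (J w) = inner ℝ v w) (v w : V) :
    inner ℝ (J v) w = -inner ℝ v (J w) := by
  rw [← hg v (J w), hJ, inner_neg_right, neg_neg]

theorem inner_complex_self (hJ : ∀ v, J (J v) = -v)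
    (hg : ∀ v w, inner ℝ (J v) (J w) = inner ℝ v w) (v : V) : inner ℝ (J v) v = 0 := by
  have := inner_complex_left hJ hg v v
  rw [real_inner_comm] at this
  have h2 := real_inner_comm v (J v)
  linarith

/-- Orthonormal bases of the form `(e, Je, f, Jf)` exist. -/
theorem exists_unitary_basis (hJ : ∀ v, J (J v) = -v)
    (hg : ∀ v w, inner ℝ (J v) (J w) = inner ℝ v w) :
    ∃ b : OrthonormalBasis (Fin 4) ℝ V, b 1 = J (b 0) ∧ b 3 = J (b 2) := by
  have hd : finrank ℝ V = 4 := Fact.out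
  have hn : ∀ v, ‖J v‖ = ‖v‖ := fun v => by
    rw [← sq_eq_sq₀ (norm_nonneg _) (norm_nonneg _), ← real_inner_self_eq_norm_sq,
      ← real_inner_self_eq_norm_sq, hg]
  set e := stdOrthonormalBasis ℝ V ⟨0, by omega⟩ with he
  have he1 : ‖e‖ = 1 := (stdOrthonormalBasis ℝ V).norm_eq_one _
  obtain ⟨f, hf1, hef, hJef⟩ : ∃ f : V, ‖f‖ = 1 ∧ inner ℝ e f = 0 ∧ inner ℝ (J e) f = 0 := by
    -- The span of `e` and `Je` has dimension at most 2 < 4, so a unit vector `f` orthogonal to it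
    -- exists; `Jf` is then orthogonal to `e` and `Je` as well, by invariance of the metric.
    set K : Submodule ℝ V := Submodule.span ℝ {e, J e}
    have hK : finrank ℝ K ≤ 2 := by
      classical
      have := finrank_span_finset_le_card (R := ℝ) (M := V) {e, J e}
      rw [Finset.coe_insert, Finset.coe_singleton] at this
      exact this.trans Finset.card_le_two
    have hK' := K.finrank_add_finrank_orthogonal
    have : Kᗮ ≠ ⊥ := by
      intro h
      rw [h, finrank_bot] at hK'
      omega
    obtain ⟨f, hf, hf0⟩ := Submodule.exists_mem_ne_zero_of_ne_bot this
    refine ⟨(‖f‖⁻¹ : ℝ) • f, norm_smul_inv_norm hf0, ?_, ?_⟩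
    · rw [inner_smul_right, (Submodule.mem_orthogonal K f).1 hf e
        (Submodule.subset_span (by simp)), mul_zero]
    · rw [inner_smul_right, (Submodule.mem_orthogonal K f).1 hf (J e)
        (Submodule.subset_span (by simp)), mul_zero]
  have h03 : inner ℝ e (J f) = 0 := by
    have := inner_complex_left hJ hg e f
    linarith
  have hon : Orthonormal ℝ ![e, J e, f, J f] := by
    rw [orthonormal_iff_ite]
    have a := inner_complex_self hJ hg e
    have c := inner_complex_self hJ hg f
    have e2 : inner ℝ e e = (1 : ℝ) := by rw [real_inner_self_eq_norm_sq, he1, one_pow]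
    have f2 : inner ℝ f f = (1 : ℝ) := by rw [real_inner_self_eq_norm_sq, hf1, one_pow]
    intro i j
    fin_cases i <;> fin_cases j <;>
      simp [hg, hn, he1, hf1, a, c, hef, hJef, h03,
        real_inner_comm e f, real_inner_comm (J e) f, real_inner_comm e (J f)] <;>
      first
      | (rw [real_inner_comm]; first | exact a | exact c)
  have hcard : Fintype.card (Fin 4) = finrank ℝ V := by rw [hd, Fintype.card_fin]
  refine ⟨OrthonormalBasis.mk hon ?_, ?_, ?_⟩
  · rw [← coe_basisOfLinearIndependentOfCardEqFinrank hon.linearIndependent hcard]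
    exact (Basis.span_eq _).ge
  · simp
  · simp

variable (o : Orientation ℝ V (Fin 4))
  (ho : ∀ b : Basis (Fin 4) ℝ V, b 1 = J (b 0) → b 3 = J (b 2) → b.orientation = o)

/-- `J` is skew for an invariant metric, so the antisymmetrization built into `skewForm` changes
nothing. -/
theorem kahlerBilin_apply (hJ : ∀ v, J (J v) = -v)
    (hg : ∀ v w, inner ℝ (J v) (J w) = inner ℝ v w) (v w : V) :
    skewForm (innerSL ℝ ∘L J) ![v, w] = inner ℝ (J v) w := by
  rw [skewForm_apply]
  change (inner ℝ (J v) w - inner ℝ (J w) v) / 2 = _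
  have h1 := inner_complex_left hJ hg w v
  have h2 := real_inner_comm w (J v)
  linarith

theorem skewForm_comp_apply {B : V →L[ℝ] V →L[ℝ] ℝ} (hs : ∀ v w, B v w = B w v)
    (hJ : ∀ v, J (J v) = -v) (hB : ∀ v w, B (J v) (J w) = B v w) (v w : V) :
    skewForm (B ∘L J) ![v, w] = B (J v) w := by
  rw [skewForm_apply]
  simp only [ContinuousLinearMap.comp_apply]
  have h1 := hB w (J v)
  rw [hJ, map_neg, hs w (J v)] at h1
  linarith

include ho

/-- The Kähler form is self-dual. -/
theorem hodgeStar_kahlerForm (hJ : ∀ v, J (J v) = -v)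
    (hg : ∀ v w, inner ℝ (J v) (J w) = inner ℝ v w) :
    hodgeStar o (skewForm (innerSL ℝ ∘L J)) = skewForm (innerSL ℝ ∘L J) := by
  obtain ⟨b, h1, h3⟩ := exists_unitary_basis hJ hg
  have hb := ho b.toBasis (by simpa using h1) (by simpa using h3)
  obtain ⟨h01, h02, h03, h12, h13, h23⟩ :=
    hodgeStar_orthonormalBasis o b hb (skewForm (innerSL ℝ ∘L J))
  have e1 : J (b 1) = -b 0 := by rw [h1, hJ]
  have e3 : J (b 3) = -b 2 := by rw [h3, hJ]
  refine twoForm_ext_basis b.toBasis ?_ ?_ ?_ ?_ ?_ ?_ <;>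
    simp only [OrthonormalBasis.coe_toBasis] <;>
    simp [h01, h02, h03, h12, h13, h23, kahlerBilin_apply hJ hg, ← h1, ← h3, e1,
      b.inner_eq_ite]

/-- The primitive part of a `J`-invariant form is anti-self-dual. -/
theorem hodgeStar_primitive {B : V →L[ℝ] V →L[ℝ] ℝ} (hs : ∀ v w, B v w = B w v)
    (hJ : ∀ v, J (J v) = -v) (hg : ∀ v w, inner ℝ (J v) (J w) = inner ℝ v w)
    (hB : ∀ v w, B (J v) (J w) = B v w) :
    hodgeStar o (skewForm (B ∘L J) -
        (metricTrace (fun v w => B v w) / 4) • skewForm (innerSL ℝ ∘L J)) =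
      -(skewForm (B ∘L J) -
        (metricTrace (fun v w => B v w) / 4) • skewForm (innerSL ℝ ∘L J)) := by
  obtain ⟨b, h1, h3⟩ := exists_unitary_basis hJ hg
  have hb := ho b.toBasis (by simpa using h1) (by simpa using h3)
  have htr : metricTrace (fun v w => B v w) = ∑ i, B (b i) (b i) :=
    metricTrace_eq b ((ContinuousLinearMap.coeLM ℝ) ∘ₗ (B : V →ₗ[ℝ] V →L[ℝ] ℝ))
  generalize metricTrace (fun v w => B v w) = s at htr ⊢
  rw [Fin.sum_univ_four] at htr
  obtain ⟨h01, h02, h03, h12, h13, h23⟩ :=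
    hodgeStar_orthonormalBasis o b hb (skewForm (B ∘L J) -
        (s / 4) • skewForm (innerSL ℝ ∘L J))
  have e1 : J (b 1) = -b 0 := by rw [h1, hJ]
  have e3 : J (b 3) = -b 2 := by rw [h3, hJ]
  -- Invariance gives `B₁₁ = B₀₀`, `B₃₃ = B₂₂`, `B₁₃ = B₀₂` and `B₁₂ = -B₀₃`. So `s / 4` is the mean
  -- of `B₀₀` and `B₂₂`, and subtracting it makes the components `01` and `23` opposite.
  have i00 := hB (b 0) (b 0)
  have i22 := hB (b 2) (b 2)
  have i02 := hB (b 0) (b 2)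
  have i03 := hB (b 0) (b 3)
  simp only [← h1, ← h3, e3, map_neg] at i00 i22 i02 i03
  have s1 := hs (b 1) (b 2)
  have s2 := hs (b 3) (b 0)
  have s3 := hs (b 2) (b 0)
  have s4 := hs (b 3) (b 1)
  refine twoForm_ext_basis b.toBasis ?_ ?_ ?_ ?_ ?_ ?_ <;>
    simp only [OrthonormalBasis.coe_toBasis, h01, h02, h03, h12, h13, h23,
      ContinuousAlternatingMap.sub_apply, ContinuousAlternatingMap.neg_apply,
      ContinuousAlternatingMap.smul_apply, smul_eq_mul, kahlerBilin_apply hJ hg,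
      skewForm_comp_apply hs hJ hB, ← h1, ← h3, e1, b.inner_eq_ite, map_neg, inner_neg_left, neg_apply, Fin.isValue, Fin.reduceEq, if_true,
      if_false] <;>
    linarith

omit ho

/-- Since `ω(v, ·)` is the inner product with `Jv`, contraction gives `(ω ∘ β)(v, w) = β(Jv, w)`;
for `β = B(J·, ·) - c ω` the two factors of `J` combine to `-1`. -/
theorem formComp_kahlerForm {B : V →L[ℝ] V →L[ℝ] ℝ} (hs : ∀ v w, B v w = B w v)
    (hJ : ∀ v, J (J v) = -v) (hg : ∀ v w, inner ℝ (J v) (J w) = inner ℝ v w)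
    (hB : ∀ v w, B (J v) (J w) = B v w) (c : ℝ) (v w : V) :
    formComp (skewForm (innerSL ℝ ∘L J))
        (skewForm (B ∘L J) - c • skewForm (innerSL ℝ ∘L J)) v w =
      -(B v w - c * inner ℝ v w) := by
  let β := twoFormBilin (skewForm (B ∘L J) - c • skewForm (innerSL ℝ ∘L J))
  have hβ : ∀ x, β x w = B (J x) w - c * inner ℝ (J x) w := fun x => by
    rw [← skewForm_comp_apply hs hJ hB, ← kahlerBilin_apply hJ hg]
    rfl
  have h1 : formComp (skewForm (innerSL ℝ ∘L J))
      (skewForm (B ∘L J) - c • skewForm (innerSL ℝ ∘L J)) v w = β (J v) w := by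
    set e := stdOrthonormalBasis ℝ V
    conv_rhs => rw [← e.sum_repr' (J v)]
    simp only [map_sum, map_smul, LinearMap.sum_apply, LinearMap.smul_apply, smul_eq_mul,
      real_inner_comm, formComp]
    refine Finset.sum_congr rfl fun l _ => ?_
    rw [kahlerBilin_apply hJ hg, real_inner_comm]
    rfl
  rw [h1, hβ, hJ, map_neg, inner_neg_left, neg_apply]
  ring

end SelfDuality

/-! ## Local Riemannian geometry -/

section LocalMetric

variable {E : Type*} [NormedAddCommGroup E] [NormedSpace ℝ E]

/-- `h` is a smooth Riemannian metric on the open set `U`. -/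
structure IsMetricOn (h : E → E →L[ℝ] E →L[ℝ] ℝ) (U : Set E) : Prop where
  isOpen : IsOpen U
  smooth : ContDiffOn ℝ ∞ h U
  symm : ∀ y ∈ U, ∀ v w, h y v w = h y w v
  pos : ∀ y ∈ U, ∀ v, v ≠ 0 → 0 < h y v v

theorem fderiv_fderiv_swap {F : Type*} [NormedAddCommGroup F] [NormedSpace ℝ F] {f : E → F}
    {y : E} (hf : ContDiffAt ℝ ∞ f y) (u v : E) :
    fderiv ℝ (fderiv ℝ f) y u v = fderiv ℝ (fderiv ℝ f) y v u :=
  (hf.isSymmSndFDerivAt (by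
    rw [minSmoothness_of_isRCLikeNormedField]; exact ENat.LEInfty.out)).eq u v

theorem contDiffAt_fderiv {F : Type*} [NormedAddCommGroup F] [NormedSpace ℝ F] {f : E → F}
    {y : E} (hf : ContDiffAt ℝ ∞ f y) : ContDiffAt ℝ ∞ (fderiv ℝ f) y :=
  hf.fderiv_right (by simp)

theorem ContDiffAt.hasFDerivAt_top {F : Type*} [NormedAddCommGroup F] [NormedSpace ℝ F]
    {f : E → F} {y : E} (hf : ContDiffAt ℝ ∞ f y) : HasFDerivAt f (fderiv ℝ f y) y :=
  (hf.differentiableAt (by simp)).hasFDerivAt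

theorem ContDiffAt.clm_flip {F G K : Type*} [NormedAddCommGroup F] [NormedSpace ℝ F]
    [NormedAddCommGroup G] [NormedSpace ℝ G] [NormedAddCommGroup K] [NormedSpace ℝ K]
    {f : E → F →L[ℝ] G →L[ℝ] K} {y : E} (hf : ContDiffAt ℝ ∞ f y) :
    ContDiffAt ℝ ∞ (fun z => (f z).flip) y :=
  (ContinuousLinearMap.flipₗᵢ ℝ F G K).toContinuousLinearEquiv.contDiff.contDiffAt.comp y hf

/-- Functions that agree on an open set have the same derivative there. -/
theorem hasFDerivAt_unique_of_eqOn {F : Type*} [NormedAddCommGroup F] [NormedSpace ℝ F]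
    {f g : E → F} {f' g' : E →L[ℝ] F} {U : Set E} (hU : IsOpen U) {y : E} (hy : y ∈ U)
    (hfg : ∀ z ∈ U, f z = g z) (hf : HasFDerivAt f f' y) (hg : HasFDerivAt g g' y) : f' = g' :=
  hf.unique (hg.congr_of_eventuallyEq (Filter.eventually_of_mem (hU.mem_nhds hy) hfg))

section

set_option linter.unusedSectionVars false

variable [FiniteDimensional ℝ E]

theorem localRiemann_eq (h : E → E →L[ℝ] E →L[ℝ] ℝ) (y u v : E) :
    localRiemann h y u v = fderiv ℝ (localChristoffel h) y u v -
      fderiv ℝ (localChristoffel h) y v u + localChristoffel h y u * localChristoffel h y v -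
      localChristoffel h y v * localChristoffel h y u := rfl

theorem localRiemann_antisymm (h : E → E →L[ℝ] E →L[ℝ] ℝ) (y u v w : E) : localRiemann h y u v w = -localRiemann h y v u w := by
  simp only [localRiemann_apply]
  abel

end

namespace IsMetricOn

variable {h : E → E →L[ℝ] E →L[ℝ] ℝ} {U : Set E} (H : IsMetricOn h U) {y : E} (hy : y ∈ U)

include H hy

theorem contDiffAt : ContDiffAt ℝ ∞ h y := H.smooth.contDiffAt (H.isOpen.mem_nhds hy)

/-- Nondegeneracy of the metric: vector identities below are proved by lowering an index and testing
against every vector. -/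
theorem eq_of_forall {v w : E} (hvw : ∀ z, h y v z = h y w z) : v = w := by
  by_contra hne
  have := H.pos y hy (v - w) (sub_ne_zero.2 hne)
  rw [map_sub (h y (v - w)), map_sub (h y), sub_apply, sub_apply, hvw, hvw, sub_self, sub_self,
    sub_self] at this
  exact lt_irrefl _ this

theorem fderiv_symm (u v w : E) : fderiv ℝ h y u v w = fderiv ℝ h y u w v := by
  have h1 := ((H.contDiffAt hy).hasFDerivAt_top.clm_apply (hasFDerivAt_const v y)).clm_apply
    (hasFDerivAt_const w y)
  have h2 := ((H.contDiffAt hy).hasFDerivAt_top.clm_apply (hasFDerivAt_const w y)).clm_apply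
    (hasFDerivAt_const v y)
  have := hasFDerivAt_unique_of_eqOn H.isOpen hy (fun z hz => H.symm z hz v w) h1 h2
  simpa using congrArg (fun L => L u) this

variable [FiniteDimensional ℝ E]

/-- Needed because `ContinuousLinearMap.inverse` is zero by default: only for an invertible `h y`
does `localChristoffel` satisfy the Koszul formula. -/
theorem isInvertible : (h y).IsInvertible := by
  have hinj : Function.Injective (h y : E →ₗ[ℝ] E →L[ℝ] ℝ) := fun v w hvw =>
    H.eq_of_forall hy fun z => congrArg (fun L : E →L[ℝ] ℝ => L z) hvw
  have hfin : finrank ℝ E = finrank ℝ (E →L[ℝ] ℝ) := by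
    rw [← (LinearMap.toContinuousLinearMap : (E →ₗ[ℝ] ℝ) ≃ₗ[ℝ] E →L[ℝ] ℝ).finrank_eq]
    exact (Subspace.dual_finrank_eq).symm
  refine ⟨(LinearEquiv.ofInjectiveOfFinrankEq _ hinj hfin).toContinuousLinearEquiv, ?_⟩
  ext v w
  rfl

theorem christoffel_apply (u v w : E) :
    h y (localChristoffel h y u v) w =
      (1 / 2) * (fderiv ℝ h y u v w + fderiv ℝ h y v u w - fderiv ℝ h y w u v) := by
  rw [localChristoffel_apply, map_smul, smul_apply, smul_eq_mul, ← localKoszul_apply]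
  congr 2
  exact ((H.isInvertible hy).inverse_apply_eq.1 rfl).symm

theorem christoffel_symm (u v : E) : localChristoffel h y u v = localChristoffel h y v u := by
  refine H.eq_of_forall hy fun z => ?_
  rw [H.christoffel_apply hy, H.christoffel_apply hy, H.fderiv_symm hy z u v]
  ring

/-- This is `∇h = 0`: adding the two Koszul formulas cancels all derivatives of `h` but one. -/
theorem compat (u v w : E) :
    fderiv ℝ h y u v w =
      h y (localChristoffel h y u v) w + h y v (localChristoffel h y u w) := by
  rw [H.symm y hy v, H.christoffel_apply hy, H.christoffel_apply hy, H.fderiv_symm hy w u v,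
    H.fderiv_symm hy u v w, H.fderiv_symm hy v u w]
  ring

theorem contDiffAt_inverse : ContDiffAt ℝ ∞ (fun z => (h z).inverse) y := by
  obtain ⟨e, he⟩ := H.isInvertible hy
  have := contDiffAt_map_inverse (𝕜 := ℝ) (n := ∞) e
  rw [he] at this
  exact this.comp y (H.contDiffAt hy)

theorem contDiffAt_christoffel : ContDiffAt ℝ ∞ (localChristoffel h) y := by
  have h1 := contDiffAt_fderiv (H.contDiffAt hy)
  have h2 := H.contDiffAt_inverse hy
  have h3 : ContDiffAt ℝ ∞ (fun z => (fderiv ℝ h z).flip) y := h1.clm_flip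
  have h4 : ContDiffAt ℝ ∞ (localKoszul h) y :=
    (h1.add h3).sub (contDiffAt_const.clm_comp h3)
  exact ContDiffAt.const_smul (1 / 2 : ℝ)
    ((((ContinuousLinearMap.compL ℝ E (E →L[ℝ] ℝ) E).contDiff.contDiffAt.comp y h2)).clm_comp h4)

theorem fderiv_christoffel_symm (u v w : E) :
    fderiv ℝ (localChristoffel h) y u v w = fderiv ℝ (localChristoffel h) y u w v := by
  have h0 := (H.contDiffAt_christoffel hy).hasFDerivAt_top
  have h1 := (h0.clm_apply (hasFDerivAt_const v y)).clm_apply (hasFDerivAt_const w y)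
  have h2 := (h0.clm_apply (hasFDerivAt_const w y)).clm_apply (hasFDerivAt_const v y)
  have := hasFDerivAt_unique_of_eqOn H.isOpen hy (fun z hz => H.christoffel_symm hz v w) h1 h2
  simpa using congrArg (fun L => L u) this

/-- First Bianchi identity. -/
theorem bianchi (u v w : E) :
    localRiemann h y u v w + localRiemann h y v w u + localRiemann h y w u v = 0 := by
  simp only [localRiemann_apply]
  rw [H.fderiv_christoffel_symm hy v u w, H.fderiv_christoffel_symm hy u w v,
    H.fderiv_christoffel_symm hy w v u, H.christoffel_symm hy u w, H.christoffel_symm hy v u,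
    H.christoffel_symm hy w v]
  abel

/-- Differentiating `compat` once more expresses the second derivatives of `h` through `Γ`; their
symmetry in the two directions is the skewness of the curvature. -/
theorem riemann_skew (u v w z : E) :
    h y (localRiemann h y u v w) z + h y w (localRiemann h y u v z) = 0 := by
  have h0 := (H.contDiffAt hy).hasFDerivAt_top
  have h1 := (contDiffAt_fderiv (H.contDiffAt hy)).hasFDerivAt_top
  have hΓ := (H.contDiffAt_christoffel hy).hasFDerivAt_top
  have key : ∀ a b : E, fderiv ℝ (fderiv ℝ h) y a b w z =
      fderiv ℝ h y a (localChristoffel h y b w) z +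
      h y (fderiv ℝ (localChristoffel h) y a b w) z +
      (fderiv ℝ h y a w (localChristoffel h y b z) +
        h y w (fderiv ℝ (localChristoffel h) y a b z)) := by
    intro a b
    have l := ((h1.clm_apply (hasFDerivAt_const b y)).clm_apply
      (hasFDerivAt_const w y)).clm_apply (hasFDerivAt_const z y)
    have r1 := (h0.clm_apply ((hΓ.clm_apply (hasFDerivAt_const b y)).clm_apply
      (hasFDerivAt_const w y))).clm_apply (hasFDerivAt_const z y)
    have r2 := (h0.clm_apply (hasFDerivAt_const w y)).clm_apply
      ((hΓ.clm_apply (hasFDerivAt_const b y)).clm_apply (hasFDerivAt_const z y))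
    have := hasFDerivAt_unique_of_eqOn H.isOpen hy (fun x hx => H.compat hx b w z) l (r1.add r2)
    have := congrArg (fun L => L a) this
    simp at this
    rw [this]
    abel
  have k1 := key u v
  have k2 := key v u
  rw [fderiv_fderiv_swap (H.contDiffAt hy) u v] at k1
  have c1 := H.compat hy u (localChristoffel h y v w) z
  have c2 := H.compat hy u w (localChristoffel h y v z)
  have c3 := H.compat hy v (localChristoffel h y u w) z
  have c4 := H.compat hy v w (localChristoffel h y u z)
  simp only [localRiemann_apply, map_sub, map_add, sub_apply, add_apply]
  linarith

theorem riemann_pair_symm (u v w z : E) :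
    h y (localRiemann h y u v w) z = h y (localRiemann h y w z u) v := by
  have B : ∀ a b c d, h y (localRiemann h y a b c) d + h y (localRiemann h y b c a) d +
      h y (localRiemann h y c a b) d = 0 := fun a b c d => by
    have := congrArg (fun x => h y x d) (H.bianchi hy a b c)
    simpa only [map_add, add_apply, map_zero, zero_apply] using this
  have A : ∀ a b c d, h y (localRiemann h y a b c) d = -h y (localRiemann h y b a c) d :=
    fun a b c d => by rw [localRiemann_antisymm h y, map_neg, neg_apply]
  have S : ∀ a b c d, h y (localRiemann h y a b c) d = -h y (localRiemann h y a b d) c :=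
    fun a b c d => by
      have := H.riemann_skew hy a b c d
      rw [H.symm y hy c] at this
      linarith
  -- The classical octahedron argument: four Bianchi identities, each vector occupying the last slot
  -- once, are combined using skewness in the first and in the second pair of slots.
  linarith [B u v w z, B v w z u, B w z u v, B z u v w, A u v w z, A w z u v, S u v w z,
    S w z u v, A v w u z, A v w z u, S v w u z, A w u v z, A w u z v, S w u v z, S u w v z,
    S v w z u, A z u v w, S z u v w, S u z v w, A z u w v, S v z u w, A v z u w, A z v w u,
    S z v w u, S z v u w, A z v u w, A v z w u, S v z w u]

/-- Endomorphisms that are adjoint with respect to the metric have the same trace. -/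
theorem trace_eq_of_adjoint {A B : E →ₗ[ℝ] E} (hAB : ∀ v w, h y (A v) w = h y v (B w)) :
    LinearMap.trace ℝ E A = LinearMap.trace ℝ E B := by
  obtain ⟨e, he⟩ := H.isInvertible hy
  -- Lowering an index conjugates `A` into the transpose of `B`, and both conjugation and
  -- transposition preserve the trace.
  let f : E ≃ₗ[ℝ] Dual ℝ E := e.toLinearEquiv.trans LinearMap.toContinuousLinearMap.symm
  have hf : ∀ v w, f v w = h y v w := fun v w => by rw [← he]; rfl
  rw [← LinearMap.trace_conj' A f, ← LinearMap.trace_transpose' B]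
  congr 1
  ext x w
  obtain ⟨v, rfl⟩ := f.surjective x
  rw [LinearEquiv.conj_apply]
  simp [hf, hAB, Module.Dual.transpose_apply]

/-- By pair symmetry and skewness, `a ↦ R(a, v)w` and `b ↦ R(b, w)v` are adjoint for the metric, so
their traces agree. -/
theorem ricci_symm (v w : E) : localRicci h y v w = localRicci h y w v := by
  rw [localRicci_apply, localRicci_apply]
  refine H.trace_eq_of_adjoint hy fun a b => ?_
  change h y (localRiemann h y a v w) b = h y a (localRiemann h y b w v)
  have h1 := H.riemann_pair_symm hy a v w b
  have h2 := H.riemann_skew hy b w a v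
  rw [localRiemann_antisymm h y b w a, map_neg, neg_apply] at h2
  linarith

theorem contDiffAt_riemann : ContDiffAt ℝ ∞ (localRiemann h) y := by
  have h0 := H.contDiffAt_christoffel hy
  have h1 := contDiffAt_fderiv h0
  have h2 : ContDiffAt ℝ ∞ (fun z => (ContinuousLinearMap.compL ℝ E E E).bilinearComp
      (localChristoffel h z) (localChristoffel h z)) y := by
    have : ContDiffAt ℝ ∞ (fun z => (ContinuousLinearMap.compL ℝ E E E) ∘L
        (localChristoffel h z)) y := contDiffAt_const.clm_comp h0
    exact (this.clm_flip.clm_comp h0).clm_flip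
  exact ((h1.sub h1.clm_flip).add h2).sub h2.clm_flip

theorem contDiffAt_ricci : ContDiffAt ℝ ∞ (localRicci h) y := by
  have h1 : ContDiffAt ℝ ∞ (fun z => (localRiemann h z).flip) y :=
    (H.contDiffAt_riemann hy).clm_flip
  exact contDiffAt_const.clm_comp (contDiffAt_const.clm_comp h1)

/-- Second Bianchi identity. -/
theorem bianchi_second (u v w : E) :
    fderiv ℝ (localRiemann h) y w u v + fderiv ℝ (localRiemann h) y u v w +
      fderiv ℝ (localRiemann h) y v w u =
    (localRiemann h y u v * localChristoffel h y w -
      localChristoffel h y w * localRiemann h y u v) +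
    (localRiemann h y v w * localChristoffel h y u -
      localChristoffel h y u * localRiemann h y v w) +
    (localRiemann h y w u * localChristoffel h y v -
      localChristoffel h y v * localRiemann h y w u) := by
  have hΓ := (H.contDiffAt_christoffel hy)
  have h0 := hΓ.hasFDerivAt_top
  have h1 := (contDiffAt_fderiv hΓ).hasFDerivAt_top
  have hR := (H.contDiffAt_riemann hy).hasFDerivAt_top
  -- Only partial derivatives of `R` occur here; the commutators with `Γ` in the statement are what
  -- distinguishes them from covariant ones. In the cyclic sum the second derivatives of `Γ` cancel
  -- by symmetry, leaving products of `Γ` with its first derivatives.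
  have key : ∀ a b c : E, fderiv ℝ (localRiemann h) y a b c =
      fderiv ℝ (fderiv ℝ (localChristoffel h)) y a b c -
      fderiv ℝ (fderiv ℝ (localChristoffel h)) y a c b +
      (fderiv ℝ (localChristoffel h) y a b * localChristoffel h y c +
        localChristoffel h y b * fderiv ℝ (localChristoffel h) y a c) -
      (fderiv ℝ (localChristoffel h) y a c * localChristoffel h y b +
        localChristoffel h y c * fderiv ℝ (localChristoffel h) y a b) := by
    intro a b c
    have l := (hR.clm_apply (hasFDerivAt_const b y)).clm_apply (hasFDerivAt_const c y)
    have d := fun p q : E =>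
      (h1.clm_apply (hasFDerivAt_const p y)).clm_apply (hasFDerivAt_const q y)
    have g := fun p : E => h0.clm_apply (hasFDerivAt_const p y)
    have r := (((d b c).sub (d c b)).add ((g b).clm_comp (g c))).sub ((g c).clm_comp (g b))
    have := congrArg (fun L => L a) (l.unique r)
    ext x
    have := congrArg (fun L => L x) this
    simp at this
    rw [this]
    simp
    abel
  simp only [key, localRiemann_eq]
  rw [fderiv_fderiv_swap hΓ w u, fderiv_fderiv_swap hΓ v w, fderiv_fderiv_swap hΓ u v]
  noncomm_ring

end IsMetricOn

end LocalMetric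

/-! ## Local Kähler geometry -/

section LocalKahler

variable {E : Type*} [NormedAddCommGroup E] [NormedSpace ℝ E]

/-- `(h, J)` is a Kähler structure on the open set `U`: the Nijenhuis tensor of `J` and the
exterior derivative of `h(J·, ·)` vanish on constant vector fields. -/
structure IsKahlerOn (h : E → E →L[ℝ] E →L[ℝ] ℝ) (J : E → E →L[ℝ] E) (U : Set E) : Prop
    extends IsMetricOn h U where
  smoothJ : ContDiffOn ℝ ∞ J U
  sq : ∀ y ∈ U, ∀ v, J y (J y v) = -v
  herm : ∀ y ∈ U, ∀ v w, h y (J y v) (J y w) = h y v w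
  nijenhuis : ∀ y ∈ U, ∀ u v, fderiv ℝ J y (J y u) v - fderiv ℝ J y (J y v) u
    + J y (fderiv ℝ J y v u) - J y (fderiv ℝ J y u v) = 0
  closed : ∀ y ∈ U, ∀ u v w,
    (fderiv ℝ h y u (J y v) w + h y (fderiv ℝ J y u v) w) +
    (fderiv ℝ h y v (J y w) u + h y (fderiv ℝ J y v w) u) +
    (fderiv ℝ h y w (J y u) v + h y (fderiv ℝ J y w u) v) = 0

namespace IsKahlerOn

variable {h : E → E →L[ℝ] E →L[ℝ] ℝ} {J : E → E →L[ℝ] E} {U : Set E} (H : IsKahlerOn h J U)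
  {y : E} (hy : y ∈ U)

include H hy

theorem contDiffAt_complex : ContDiffAt ℝ ∞ J y := H.smoothJ.contDiffAt (H.isOpen.mem_nhds hy)

theorem metric_complex_left (v w : E) : h y (J y v) w = -h y v (J y w) := by
  rw [← H.herm y hy v (J y w), H.sq y hy, map_neg, neg_neg]

theorem fderiv_complex_anticomm (u v : E) :
    fderiv ℝ J y u (J y v) + J y (fderiv ℝ J y u v) = 0 := by
  have h0 := (H.contDiffAt_complex hy).hasFDerivAt_top
  have l := h0.clm_apply (h0.clm_apply (hasFDerivAt_const v y))
  have := hasFDerivAt_unique_of_eqOn H.isOpen hy (fun z hz => H.sq z hz v) l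
    (hasFDerivAt_const (-v) y)
  have := congrArg (fun L => L u) this
  simp at this
  rw [← this]
  abel

theorem fderiv_metric_complex (u v w : E) :
    fderiv ℝ h y u (J y v) w + h y (fderiv ℝ J y u v) w +
      (fderiv ℝ h y u v (J y w) + h y v (fderiv ℝ J y u w)) = 0 := by
  have h0 := (H.contDiffAt_complex hy).hasFDerivAt_top
  have h1 := (H.contDiffAt hy).hasFDerivAt_top
  have l := (h1.clm_apply (h0.clm_apply (hasFDerivAt_const v y))).clm_apply (hasFDerivAt_const w y)
  have r := (h1.clm_apply (hasFDerivAt_const v y)).clm_apply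
    (h0.clm_apply (hasFDerivAt_const w y))
  have := hasFDerivAt_unique_of_eqOn H.isOpen hy (fun z hz => H.metric_complex_left hz v w) l r.neg
  have := congrArg (fun L => L u) this
  simp at this
  linarith

variable [FiniteDimensional ℝ E]

/-- The complex structure of a Kähler metric is parallel. -/
theorem parallel (u v : E) :
    fderiv ℝ J y u v = J y (localChristoffel h y u v) - localChristoffel h y u (J y v) := by
  -- `D u v` is `(∇_u J)v`. It anticommutes with `J` and is skew for the metric; `dω = 0` becomes
  -- its cyclic identity, and the Nijenhuis condition can be written with `D` in place of partial
  -- derivatives because `Γ` is symmetric.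
  let D : E → E → E := fun u v =>
    fderiv ℝ J y u v + localChristoffel h y u (J y v) - J y (localChristoffel h y u v)
  have hD : ∀ u v, D u v =
    fderiv ℝ J y u v + localChristoffel h y u (J y v) - J y (localChristoffel h y u v) :=
    fun _ _ => rfl
  have hDJ : ∀ u v, D u (J y v) = -J y (D u v) := by
    intro u v
    have := H.fderiv_complex_anticomm hy u v
    rw [← eq_neg_iff_add_eq_zero] at this
    simp only [hD, this, H.sq y hy, map_neg, map_add, map_sub]
    abel
  have skew : ∀ u v w, h y (D u v) w = -h y (D u w) v := by
    intro u v w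
    have h1 := H.fderiv_metric_complex hy u v w
    rw [H.compat hy, H.compat hy] at h1
    have h2 := H.metric_complex_left hy v (localChristoffel h y u w)
    have h3 := H.metric_complex_left hy (localChristoffel h y u v) w
    have h4 := H.symm y hy v (fderiv ℝ J y u w)
    have h5 := H.symm y hy v (localChristoffel h y u (J y w))
    have h6 := H.symm y hy v (J y (localChristoffel h y u w))
    simp only [hD, map_add, map_sub, add_apply, sub_apply]
    linarith
  have cyc : ∀ u v w, h y (D u v) w + h y (D v w) u + h y (D w u) v = 0 := by
    intro u v w
    have h1 := H.closed y hy u v w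
    rw [H.compat hy, H.compat hy, H.compat hy] at h1
    have a1 := H.metric_complex_left hy v (localChristoffel h y u w)
    have a2 := H.metric_complex_left hy w (localChristoffel h y v u)
    have a3 := H.metric_complex_left hy u (localChristoffel h y w v)
    have b1 := H.symm y hy v (J y (localChristoffel h y u w))
    have b2 := H.symm y hy w (J y (localChristoffel h y v u))
    have b3 := H.symm y hy u (J y (localChristoffel h y w v))
    rw [H.christoffel_symm hy v u] at a2 b2 h1
    rw [H.christoffel_symm hy w v] at a3 b3 h1
    rw [H.christoffel_symm hy u w] at a1 b1 h1
    simp only [hD, map_add, map_sub, add_apply, sub_apply]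
    linarith
  have nij : ∀ u v w, h y (D (J y u) v) w - h y (D (J y v) u) w + h y (J y (D v u)) w
      - h y (J y (D u v)) w = 0 := by
    intro u v w
    have h1 := H.nijenhuis y hy u v
    have h2 : D (J y u) v - D (J y v) u + J y (D v u) - J y (D u v) = 0 := by
      rw [← h1]
      simp only [hD, map_add, map_sub, H.sq y hy]
      rw [H.christoffel_symm hy (J y u) v, H.christoffel_symm hy (J y v) u,
        H.christoffel_symm hy (J y u) (J y v), H.christoffel_symm hy v u]
      abel
    have := congrArg (fun x => h y x w) h2
    simpa only [map_add, map_sub, add_apply, sub_apply, map_zero, zero_apply] using this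
  suffices hz : D u v = 0 by
    rw [hD] at hz
    rw [eq_sub_iff_add_eq, ← sub_eq_zero]
    exact hz
  refine H.eq_of_forall hy fun w => ?_
  rw [map_zero, zero_apply]
  have sw : ∀ a b c, h y (D a (J y b)) c = h y (D a b) (J y c) := fun a b c => by
    rw [hDJ, map_neg, neg_apply, H.metric_complex_left hy, neg_neg]
  -- The cyclic identity at `(u, v, w)` minus that at `(u, Jv, Jw)` is `2 h(D_u v, w)` minus the
  -- Nijenhuis identity at `(v, w, Ju)`.
  have c1 := cyc u v w
  have c2 := cyc u (J y v) (J y w)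
  have n := nij v w (J y u)
  rw [H.herm y hy, H.herm y hy] at n
  rw [sw, H.sq y hy, map_neg, sw] at c2
  have s1 := skew w v u
  have s2 := skew (J y w) (J y u) v
  have s3 := sw (J y w) u v
  linarith [skew (J y w) v (J y u), sw (J y w) v u]

/-- The integrability condition of `∇J = 0`: differentiate `parallel` and use the symmetry of the
second derivatives of `J`. -/
theorem complex_riemann (u v w : E) :
    J y (localRiemann h y u v w) = localRiemann h y u v (J y w) := by
  have h0 := (H.contDiffAt_complex hy).hasFDerivAt_top
  have h1 := (contDiffAt_fderiv (H.contDiffAt_complex hy)).hasFDerivAt_top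
  have hΓ := (H.contDiffAt_christoffel hy).hasFDerivAt_top
  have key : ∀ a b : E, fderiv ℝ (fderiv ℝ J) y a b w =
      fderiv ℝ J y a (localChristoffel h y b w) +
        J y (fderiv ℝ (localChristoffel h) y a b w) -
      (fderiv ℝ (localChristoffel h) y a b (J y w) +
        localChristoffel h y b (fderiv ℝ J y a w)) := by
    intro a b
    have l := (h1.clm_apply (hasFDerivAt_const b y)).clm_apply (hasFDerivAt_const w y)
    have r1 := h0.clm_apply ((hΓ.clm_apply (hasFDerivAt_const b y)).clm_apply
      (hasFDerivAt_const w y))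
    have r2 := (hΓ.clm_apply (hasFDerivAt_const b y)).clm_apply
      (h0.clm_apply (hasFDerivAt_const w y))
    have := hasFDerivAt_unique_of_eqOn H.isOpen hy (fun x hx => H.parallel hx b w) l (r1.sub r2)
    have := congrArg (fun L => L a) this
    simp at this
    rw [this]
    abel
  have k1 := key u v
  rw [fderiv_fderiv_swap (H.contDiffAt_complex hy) u v, key v u] at k1
  simp only [H.parallel hy, map_sub] at k1
  rw [← sub_eq_zero] at k1 ⊢
  simp only [localRiemann_apply, map_sub, map_add]
  rw [← neg_eq_zero, ← k1]
  abel

/-- Pair symmetry carries the commutation of `J` with `R` over to the first two slots. -/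
theorem riemann_complex_complex (u v w : E) :
    localRiemann h y (J y u) (J y v) w = localRiemann h y u v w := by
  refine H.eq_of_forall hy fun z => ?_
  rw [H.riemann_pair_symm hy, ← H.complex_riemann hy, H.herm y hy, ← H.riemann_pair_symm hy]

theorem ricci_complex (v w : E) :
    localRicci h y (J y v) (J y w) = localRicci h y v w := by
  rw [localRicci_apply, localRicci_apply]
  let A : E →ₗ[ℝ] E := (((localRiemann h y).flip v).flip w : E →L[ℝ] E)
  let Jy : E →ₗ[ℝ] E := J y
  have hJJ : Jy * Jy = -1 := by
    ext x
    exact H.sq y hy x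
  -- The endomorphism whose trace is `Ric(Jv, Jw)` equals `-J A J`, where `A` is that for `Ric(v,
  -- w)`; cyclicity of the trace and `J² = -1` finish.
  have h1 : (((((localRiemann h y).flip (J y v)).flip (J y w) : E →L[ℝ] E)) : E →ₗ[ℝ] E) =
      -(Jy * (A * Jy)) := by
    ext x
    change localRiemann h y x (J y v) (J y w) = -J y (localRiemann h y (J y x) v w)
    rw [H.complex_riemann hy, ← H.riemann_complex_complex hy (J y x) v, H.sq y hy, map_neg,
      neg_apply, neg_apply, neg_neg]
  rw [h1, map_neg, LinearMap.trace_mul_comm, mul_assoc, hJJ]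
  simp [A]

/-- `r(J·, ·)` is half the trace of `J` composed with the curvature operator. -/
theorem ricci_complex_skew (u v : E) :
    localRicci h y (J y u) v - localRicci h y (J y v) u = traceCLM E (J y * localRiemann h y u v) := by
  rw [H.ricci_symm hy (J y u), H.ricci_symm hy (J y v), localRicci_apply, localRicci_apply,
    ← map_sub]
  change _ = LinearMap.trace ℝ E _
  congr 1
  ext x
  change localRiemann h y x v (J y u) - localRiemann h y x u (J y v) =
    J y (localRiemann h y u v x)
  have := congrArg (J y) (H.bianchi hy u v x)
  simp only [map_add, map_zero] at this
  rw [← H.complex_riemann hy, ← H.complex_riemann hy, localRiemann_antisymm h y x v, map_neg]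
  rw [← sub_eq_zero, ← neg_eq_zero, ← this]
  abel

/-- The Ricci form of a Kähler metric is closed. -/
theorem ricci_closed (u v w : E) :
    traceCLM E (fderiv ℝ J y w * localRiemann h y u v + J y * fderiv ℝ (localRiemann h) y w u v) +
    traceCLM E (fderiv ℝ J y u * localRiemann h y v w + J y * fderiv ℝ (localRiemann h) y u v w) +
    traceCLM E (fderiv ℝ J y v * localRiemann h y w u + J y * fderiv ℝ (localRiemann h) y v w u)
      = 0 := by
  -- Parallelism reads `∂_a J = [J, Γ_a]`, and the second Bianchi identity replaces the cyclic sum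
  -- of `∂R` by one of `[R, Γ]`. The terms cancel since `tr ([J, Γ]R + J[R, Γ]) = 0`.
  have hJ : ∀ a, fderiv ℝ J y a =
      J y * localChristoffel h y a - localChristoffel h y a * J y := fun a => by
    ext x
    exact H.parallel hy a x
  have tr : ∀ A B : E →L[ℝ] E, traceCLM E (A * B) = traceCLM E (B * A) := fun A B =>
    LinearMap.trace_mul_comm ℝ (A : E →ₗ[ℝ] E) (B : E →ₗ[ℝ] E)
  have hB := congrArg (fun X => traceCLM E (J y * X)) (H.bianchi_second hy u v w)
  simp only [mul_add, mul_sub, map_add, map_sub] at hB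
  have t1 : ∀ a b c, traceCLM E (J y * (localRiemann h y a b * localChristoffel h y c)) =
      traceCLM E (localChristoffel h y c * (J y * localRiemann h y a b)) := fun a b c => by
    rw [← mul_assoc, tr]
  simp only [hJ, sub_mul, map_add, map_sub, t1, mul_assoc] at hB ⊢
  linarith

end IsKahlerOn

end LocalKahler

/-! ## Naturality of the Ricci curvature -/

section Naturality

variable {E : Type*} [NormedAddCommGroup E] [NormedSpace ℝ E] [FiniteDimensional ℝ E]

set_option linter.unusedSectionVars false

variable {h h' : E → E →L[ℝ] E →L[ℝ] ℝ} {φ : E → E} {U U' W : Set E}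

/-- `φ` is a smooth map from the open set `W` of `(U, h)` to `(U', h')` that preserves the
metrics. -/
structure IsLocalIsometryOn (h h' : E → E →L[ℝ] E →L[ℝ] ℝ) (φ : E → E) (U U' W : Set E) :
    Prop where
  source : IsMetricOn h U
  target : IsMetricOn h' U'
  isOpen : IsOpen W
  subset : W ⊆ U
  mapsTo : ∀ y ∈ W, φ y ∈ U'
  smooth : ContDiffOn ℝ ∞ φ W
  isometry : ∀ y ∈ W, ∀ u v, h y u v = h' (φ y) (fderiv ℝ φ y u) (fderiv ℝ φ y v)

namespace IsLocalIsometryOn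

variable (H : IsLocalIsometryOn h h' φ U U' W) {y : E} (hy : y ∈ W)

include H hy

theorem contDiffAt : ContDiffAt ℝ ∞ φ y := H.smooth.contDiffAt (H.isOpen.mem_nhds hy)

theorem fderiv_injective : Function.Injective (fderiv ℝ φ y : E →ₗ[ℝ] E) := by
  rw [← LinearMap.ker_eq_bot, LinearMap.ker_eq_bot']
  intro v hv
  by_contra hne
  have := H.source.pos y (H.subset hy) v hne
  rw [H.isometry y hy, show fderiv ℝ φ y v = 0 from hv, map_zero] at this
  exact lt_irrefl _ this

/-- Transformation law of the Christoffel symbols. -/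
theorem fderiv_christoffel (u v : E) :
    fderiv ℝ φ y (localChristoffel h y u v) =
      localChristoffel h' (φ y) (fderiv ℝ φ y u) (fderiv ℝ φ y v) +
        fderiv ℝ (fderiv ℝ φ) y u v := by
  have hφ := (H.contDiffAt hy).hasFDerivAt_top
  have hφ' := (contDiffAt_fderiv (H.contDiffAt hy)).hasFDerivAt_top
  have h0 := (H.source.contDiffAt (H.subset hy)).hasFDerivAt_top
  have h0' := ((H.target.contDiffAt (H.mapsTo y hy)).hasFDerivAt_top).comp y hφ
  have key : ∀ a b c : E, fderiv ℝ h y a b c =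
      fderiv ℝ h' (φ y) (fderiv ℝ φ y a) (fderiv ℝ φ y b) (fderiv ℝ φ y c) +
      h' (φ y) (fderiv ℝ (fderiv ℝ φ) y a b) (fderiv ℝ φ y c) +
      h' (φ y) (fderiv ℝ φ y b) (fderiv ℝ (fderiv ℝ φ) y a c) := by
    intro a b c
    have l := (h0.clm_apply (hasFDerivAt_const b y)).clm_apply (hasFDerivAt_const c y)
    have r := (h0'.clm_apply (hφ'.clm_apply (hasFDerivAt_const b y))).clm_apply
      (hφ'.clm_apply (hasFDerivAt_const c y))
    have := hasFDerivAt_unique_of_eqOn H.isOpen hy (fun x hx => H.isometry x hx b c) l r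
    have := congrArg (fun L => L a) this
    simp at this
    rw [this]
    abel
  refine H.target.eq_of_forall (H.mapsTo y hy) fun z => ?_
  -- An isometry has injective, hence surjective derivative, so testing against images `dφ(w)`
  -- suffices and both Koszul formulas apply.
  obtain ⟨w, rfl⟩ := (LinearMap.injective_iff_surjective.1 (H.fderiv_injective hy)) z
  change h' (φ y) (fderiv ℝ φ y (localChristoffel h y u v)) (fderiv ℝ φ y w) =
    h' (φ y) _ (fderiv ℝ φ y w)
  rw [← H.isometry y hy, H.source.christoffel_apply (H.subset hy), key, key, key, map_add,
    add_apply, H.target.christoffel_apply (H.mapsTo y hy),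
    fderiv_fderiv_swap (H.contDiffAt hy) v u, fderiv_fderiv_swap (H.contDiffAt hy) w u,
    fderiv_fderiv_swap (H.contDiffAt hy) w v,
    H.target.symm _ (H.mapsTo y hy) (fderiv ℝ φ y v),
    H.target.symm _ (H.mapsTo y hy) (fderiv ℝ φ y u) (fderiv ℝ (fderiv ℝ φ) y v w)]
  ring

/-- Naturality of the curvature tensor. -/
theorem fderiv_riemann (u v w : E) :
    fderiv ℝ φ y (localRiemann h y u v w) =
      localRiemann h' (φ y) (fderiv ℝ φ y u) (fderiv ℝ φ y v) (fderiv ℝ φ y w) := by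
  have hφ := (H.contDiffAt hy).hasFDerivAt_top
  have hφ' := (contDiffAt_fderiv (H.contDiffAt hy)).hasFDerivAt_top
  have hφ'' := (contDiffAt_fderiv (contDiffAt_fderiv (H.contDiffAt hy))).hasFDerivAt_top
  have h0 := (H.source.contDiffAt_christoffel (H.subset hy)).hasFDerivAt_top
  have h0' := ((H.target.contDiffAt_christoffel (H.mapsTo y hy)).hasFDerivAt_top).comp y hφ
  -- The derivative of the transformation law of `Γ`. Antisymmetrizing in `a, b` removes the third
  -- derivatives of `φ`, and the law itself absorbs the remaining second derivatives.
  have key : ∀ a b c : E,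
      fderiv ℝ (fderiv ℝ φ) y a (localChristoffel h y b c) +
        fderiv ℝ φ y (fderiv ℝ (localChristoffel h) y a b c) =
      fderiv ℝ (localChristoffel h') (φ y) (fderiv ℝ φ y a) (fderiv ℝ φ y b) (fderiv ℝ φ y c) +
      localChristoffel h' (φ y) (fderiv ℝ (fderiv ℝ φ) y a b) (fderiv ℝ φ y c) +
      localChristoffel h' (φ y) (fderiv ℝ φ y b) (fderiv ℝ (fderiv ℝ φ) y a c) +
      fderiv ℝ (fderiv ℝ (fderiv ℝ φ)) y a b c := by
    intro a b c
    have l := hφ'.clm_apply ((h0.clm_apply (hasFDerivAt_const b y)).clm_apply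
      (hasFDerivAt_const c y))
    have r1 := (h0'.clm_apply (hφ'.clm_apply (hasFDerivAt_const b y))).clm_apply
      (hφ'.clm_apply (hasFDerivAt_const c y))
    have r2 := (hφ''.clm_apply (hasFDerivAt_const b y)).clm_apply (hasFDerivAt_const c y)
    have := hasFDerivAt_unique_of_eqOn H.isOpen hy (fun x hx => H.fderiv_christoffel hx b c) l
      (r1.add r2)
    have := congrArg (fun L => L a) this
    simp at this
    rw [add_comm, this]
    abel
  have k1 := key u v w
  have k2 := key v u w
  rw [← eq_sub_iff_add_eq'] at k1 k2
  simp only [localRiemann_apply, map_add, map_sub]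
  rw [k1, k2]
  simp only [H.fderiv_christoffel hy, map_add]
  rw [fderiv_fderiv_swap (H.contDiffAt hy) u v,
    fderiv_fderiv_swap (contDiffAt_fderiv (H.contDiffAt hy)) u v]
  abel

/-- Naturality of the Ricci tensor. -/
theorem ricci_eq (u v : E) :
    localRicci h y u v = localRicci h' (φ y) (fderiv ℝ φ y u) (fderiv ℝ φ y v) := by
  rw [localRicci_apply, localRicci_apply]
  let e := LinearEquiv.ofInjectiveEndo _ (H.fderiv_injective hy)
  rw [← LinearMap.trace_conj' _ e]
  congr 1
  ext x
  obtain ⟨z, rfl⟩ := e.surjective x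
  rw [LinearEquiv.conj_apply]
  simp only [LinearMap.comp_apply, LinearEquiv.coe_coe, LinearEquiv.symm_apply_apply]
  exact H.fderiv_riemann hy z u v

end IsLocalIsometryOn

end Naturality

/-! ## Charts of a Riemannian 4-manifold -/

section Charts

variable {M : Type*} [TopologicalSpace M] [ChartedSpace E4 M] [IsManifold (𝓡 4) ∞ M]

theorem contMDiffAt_extChartAt_symm {p : M} {y : E4} (hy : y ∈ (extChartAt (𝓡 4) p).target) :
    ContMDiffAt 𝓘(ℝ, E4) (𝓡 4) ∞ (extChartAt (𝓡 4) p).symm y :=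
  (contMDiffOn_extChartAt_symm p).contMDiffAt ((isOpen_extChartAt_target p).mem_nhds hy)

theorem contMDiffAt_extChartAt_of_mem {p x : M} (hx : x ∈ (extChartAt (𝓡 4) p).source) :
    ContMDiffAt (𝓡 4) 𝓘(ℝ, E4) ∞ (extChartAt (𝓡 4) p) x :=
  contMDiffAt_extChartAt' (by rwa [← extChartAt_source (𝓡 4)])

theorem mfderiv_extChartAt_comp_chartSymmDeriv {p : M} {y : E4}
    (hy : y ∈ (extChartAt (𝓡 4) p).target) :
    (mfderiv (𝓡 4) 𝓘(ℝ, E4) (extChartAt (𝓡 4) p) ((extChartAt (𝓡 4) p).symm y)) ∘L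
      chartSymmDeriv p y = ContinuousLinearMap.id ℝ E4 := by
  have := mfderiv_extChartAt_comp_mfderivWithin_extChartAt_symm (I := 𝓡 4) hy
  rw [ModelWithCorners.Boundaryless.range_eq_univ, mfderivWithin_univ] at this
  exact this

theorem chartSymmDeriv_comp_mfderiv_extChartAt {p : M} {y : E4}
    (hy : y ∈ (extChartAt (𝓡 4) p).target) :
    chartSymmDeriv p y ∘L
      (mfderiv (𝓡 4) 𝓘(ℝ, E4) (extChartAt (𝓡 4) p) ((extChartAt (𝓡 4) p).symm y)) =
        ContinuousLinearMap.id ℝ (TangentSpace (𝓡 4) ((extChartAt (𝓡 4) p).symm y)) := by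
  have := mfderivWithin_extChartAt_symm_comp_mfderiv_extChartAt (I := 𝓡 4) hy
  rw [ModelWithCorners.Boundaryless.range_eq_univ, mfderivWithin_univ] at this
  exact this

/-- The derivative at `(extChartAt p).symm y` of the chart around `p`. -/
def chartDerivAt (p : M) (y : E4) : TangentSpace (𝓡 4) ((extChartAt (𝓡 4) p).symm y) →L[ℝ] E4 :=
  mfderiv (𝓡 4) 𝓘(ℝ, E4) (extChartAt (𝓡 4) p) ((extChartAt (𝓡 4) p).symm y)

theorem chartDerivAt_chartSymmDeriv {p : M} {y : E4} (hy : y ∈ (extChartAt (𝓡 4) p).target)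
    (u : E4) : chartDerivAt p y (chartSymmDeriv p y u) = u :=
  congrArg (fun L : E4 →L[ℝ] E4 => L u) (mfderiv_extChartAt_comp_chartSymmDeriv hy)

theorem chartSymmDeriv_chartDerivAt {p : M} {y : E4} (hy : y ∈ (extChartAt (𝓡 4) p).target)
    (u : TangentSpace (𝓡 4) ((extChartAt (𝓡 4) p).symm y)) :
    chartSymmDeriv p y (chartDerivAt p y u) = u :=
  congrArg (fun L : TangentSpace (𝓡 4) ((extChartAt (𝓡 4) p).symm y) →L[ℝ]
    TangentSpace (𝓡 4) ((extChartAt (𝓡 4) p).symm y) => L u)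
    (chartSymmDeriv_comp_mfderiv_extChartAt hy)

theorem chartSymmDeriv_inverse {p : M} {y : E4} (hy : y ∈ (extChartAt (𝓡 4) p).target) :
    (chartSymmDeriv p y).inverse = chartDerivAt p y :=
  ContinuousLinearMap.inverse_eq (chartSymmDeriv_comp_mfderiv_extChartAt hy)
    (mfderiv_extChartAt_comp_chartSymmDeriv hy)

theorem chartDerivAt_inverse {p : M} {y : E4} (hy : y ∈ (extChartAt (𝓡 4) p).target) :
    (chartDerivAt p y).inverse = chartSymmDeriv p y :=
  ContinuousLinearMap.inverse_eq (mfderiv_extChartAt_comp_chartSymmDeriv hy)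
    (chartSymmDeriv_comp_mfderiv_extChartAt hy)

/-- The coordinate vector field with constant coefficients `u` in the chart around `p`. -/
def coordField (p : M) (u : E4) (x : M) : TangentSpace (𝓡 4) x :=
  VectorField.mpullback (𝓡 4) 𝓘(ℝ, E4) (extChartAt (𝓡 4) p) (fun _ => u) x

theorem coordField_symm {p : M} {y : E4} (hy : y ∈ (extChartAt (𝓡 4) p).target) (u : E4) :
    coordField p u ((extChartAt (𝓡 4) p).symm y) = chartSymmDeriv p y u := by
  rw [← chartDerivAt_inverse hy]
  rfl

theorem contMDiffAt_coordField {p x : M} (hx : x ∈ (extChartAt (𝓡 4) p).source) (u : E4) :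
    ContMDiffAt (𝓡 4) ((𝓡 4).prod 𝓘(ℝ, E4)) ∞
      (fun y => (⟨y, coordField p u y⟩ : TangentBundle (𝓡 4) M)) x := by
  refine ContMDiffAt.mpullback_vectorField_preimage (n := ∞) (V := fun _ => u) ?_
    (contMDiffAt_extChartAt_of_mem hx) (isInvertible_mfderiv_extChartAt hx) (by simp)
  exact contMDiffAt_vectorSpace_iff_contDiffAt.2 contDiffAt_const

end Charts

/-! ### The metric tensor in a chart. -/

section MetricInChart

set_option linter.unusedSectionVars false

variable {M : Type*} [TopologicalSpace M] [ChartedSpace E4 M] [IsManifold (𝓡 4) ∞ M]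
  [RiemannianBundle (fun x : M => TangentSpace (𝓡 4) x)]
  [IsContMDiffRiemannianBundle (𝓡 4) ∞ E4 (fun x : M => TangentSpace (𝓡 4) x)]

/-- The inner product of smooth vector fields is smooth in charts. -/
theorem contDiffAt_inner_vectorField {V W : ∀ x : M, TangentSpace (𝓡 4) x} {p : M} {y : E4}
    (hy : y ∈ (extChartAt (𝓡 4) p).target)
    (hV : ContMDiffAt (𝓡 4) ((𝓡 4).prod 𝓘(ℝ, E4)) ∞
      (fun y => (⟨y, V y⟩ : TangentBundle (𝓡 4) M)) ((extChartAt (𝓡 4) p).symm y))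
    (hW : ContMDiffAt (𝓡 4) ((𝓡 4).prod 𝓘(ℝ, E4)) ∞
      (fun y => (⟨y, W y⟩ : TangentBundle (𝓡 4) M)) ((extChartAt (𝓡 4) p).symm y)) :
    ContDiffAt ℝ ∞ (fun z => inner ℝ (V ((extChartAt (𝓡 4) p).symm z))
      (W ((extChartAt (𝓡 4) p).symm z))) y := by
  rw [← contMDiffAt_iff_contDiffAt]
  exact (ContMDiffAt.inner_bundle (E := fun x : M => TangentSpace (𝓡 4) x) (b := fun x => x)
    hV hW).comp y (contMDiffAt_extChartAt_symm hy)

theorem metricInChart_apply (p : M) (y u v : E4) :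
    metricInChart p y u v = inner ℝ (chartSymmDeriv p y u) (chartSymmDeriv p y v) := rfl

/-- A family of bilinear forms is smooth if its values on constant vectors are. -/
theorem contDiffOn_bilin {B : E4 → E4 →L[ℝ] E4 →L[ℝ] ℝ} {U : Set E4}
    (hB : ∀ u v, ContDiffOn ℝ ∞ (fun z => B z u v) U) : ContDiffOn ℝ ∞ B U :=
  contDiffOn_clm_apply.2 fun u => contDiffOn_clm_apply.2 fun v => hB u v

theorem isMetricOn_metricInChart (p : M) :
    IsMetricOn (metricInChart p) (extChartAt (𝓡 4) p).target where
  isOpen := isOpen_extChartAt_target p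
  smooth := contDiffOn_bilin fun u v y hy => by
    refine ContDiffAt.contDiffWithinAt ?_
    refine (contDiffAt_inner_vectorField hy
      (contMDiffAt_coordField ((extChartAt (𝓡 4) p).map_target hy) u)
      (contMDiffAt_coordField ((extChartAt (𝓡 4) p).map_target hy) v)).congr_of_eventuallyEq ?_
    filter_upwards [(isOpen_extChartAt_target p).mem_nhds hy] with z hz
    rw [coordField_symm hz, coordField_symm hz, metricInChart_apply]
  symm := fun y _ v w => by rw [metricInChart_apply, metricInChart_apply, real_inner_comm]
  pos := fun y hy v hv => by
    rw [metricInChart_apply]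
    refine real_inner_self_pos.2 fun h0 => hv ?_
    rw [← chartDerivAt_chartSymmDeriv hy v, h0, map_zero]

end MetricInChart

/-! ## Changes of charts -/

section Transition

set_option linter.unusedSectionVars false

variable {M : Type*} [TopologicalSpace M] [ChartedSpace E4 M] [IsManifold (𝓡 4) ∞ M]

/-- The change of coordinates from the chart around `p` to the chart around `q`. -/
def transition (p q : M) (y : E4) : E4 := extChartAt (𝓡 4) q ((extChartAt (𝓡 4) p).symm y)

/-- The domain of the change of coordinates. -/
def transitionSource (p q : M) : Set E4 :=
  (extChartAt (𝓡 4) p).target ∩ (extChartAt (𝓡 4) p).symm ⁻¹' (extChartAt (𝓡 4) q).source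

theorem isOpen_transitionSource (p q : M) : IsOpen (transitionSource p q) :=
  (continuousOn_extChartAt_symm p).isOpen_inter_preimage (isOpen_extChartAt_target p)
    (isOpen_extChartAt_source q)

variable {p q : M} {y : E4} (hy : y ∈ transitionSource p q)

include hy

theorem contDiffAt_transition : ContDiffAt ℝ ∞ (transition p q) y := by
  rw [← contMDiffAt_iff_contDiffAt]
  exact (contMDiffAt_extChartAt_of_mem hy.2).comp y (contMDiffAt_extChartAt_symm hy.1)

theorem transition_mem : transition p q y ∈ (extChartAt (𝓡 4) q).target :=
  (extChartAt (𝓡 4) q).map_source hy.2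

theorem symm_transition :
    (extChartAt (𝓡 4) q).symm (transition p q y) = (extChartAt (𝓡 4) p).symm y :=
  (extChartAt (𝓡 4) q).left_inv hy.2

/-- The two sides are tangent at base points that are only propositionally equal; the ascription to
`E4`, to which each tangent space unfolds, lets them be compared. -/
theorem chartSymmDeriv_transition (u : E4) :
    (chartSymmDeriv p y u : E4) =
      chartSymmDeriv q (transition p q y) (fderiv ℝ (transition p q) y u) := by
  have h1 : (extChartAt (𝓡 4) p).symm =ᶠ[𝓝 y] (extChartAt (𝓡 4) q).symm ∘ transition p q := by
    filter_upwards [(isOpen_transitionSource p q).mem_nhds hy] with z hz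
    exact (symm_transition hz).symm
  have h2 : (mfderiv 𝓘(ℝ, E4) (𝓡 4) (extChartAt (𝓡 4) p).symm y : E4 →L[ℝ] E4) =
      mfderiv 𝓘(ℝ, E4) (𝓡 4) ((extChartAt (𝓡 4) q).symm ∘ transition p q) y := h1.mfderiv_eq
  have h3 := mfderiv_comp y
    ((contMDiffAt_extChartAt_symm (transition_mem hy)).mdifferentiableAt (by simp))
    ((contMDiffAt_iff_contDiffAt.2 (contDiffAt_transition hy)).mdifferentiableAt (by simp))
  rw [mfderiv_eq_fderiv] at h3
  exact congrArg (fun L : E4 →L[ℝ] E4 => L u) (h2.trans h3)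

theorem fderiv_transition :
    fderiv ℝ (transition p q) y =
      mfderiv (𝓡 4) 𝓘(ℝ, E4) (extChartAt (𝓡 4) q) ((extChartAt (𝓡 4) p).symm y) ∘L
        chartSymmDeriv p y := by
  rw [← mfderiv_eq_fderiv]
  exact mfderiv_comp y ((contMDiffAt_extChartAt_of_mem hy.2).mdifferentiableAt (by simp))
    ((contMDiffAt_extChartAt_symm hy.1).mdifferentiableAt (by simp))

theorem formInChart_transition {k : ℕ}
    (α : ∀ x : M, TangentSpace (𝓡 4) x [⋀^Fin k]→L[ℝ] ℝ) :
    formInChart α p y = (formInChart α q (transition p q y)).compContinuousLinearMap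
      (fderiv ℝ (transition p q) y) := by
  have key : ∀ {x z : M} (_ : x = z) (v : Fin k → E4), α x v = α z v := by
    rintro x _ rfl v
    rfl
  ext v
  have h1 : (fun i => (chartSymmDeriv p y (v i) : E4)) = fun i =>
      (chartSymmDeriv q (transition p q y) (fderiv ℝ (transition p q) y (v i)) : E4) :=
    funext fun i => chartSymmDeriv_transition hy (v i)
  exact (key (symm_transition hy).symm (fun i => (chartSymmDeriv p y (v i) : E4))).trans
    (congrArg (α _) h1)

omit hy

theorem mem_transitionSource_self (hy : y ∈ (extChartAt (𝓡 4) p).target) :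
    y ∈ transitionSource p ((extChartAt (𝓡 4) p).symm y) :=
  ⟨hy, mem_extChartAt_source _⟩

/-- At its own base point the preferred chart has identity derivative, so no pullback remains. -/
theorem dForm_apply {k : ℕ} (α : ∀ x : M, TangentSpace (𝓡 4) x [⋀^Fin k]→L[ℝ] ℝ) (x : M)
    (v : Fin (k + 1) → E4) :
    dForm α x v = extDeriv (formInChart α x) (extChartAt (𝓡 4) x x) v := by
  have : chartDeriv x = ContinuousLinearMap.id ℝ E4 := mfderiv_extChartAt_self
  rw [dForm, this]
  rfl

/-- A smooth form that is closed is closed in every chart. -/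
theorem extDeriv_formInChart_eq_zero {k : ℕ}
    {α : ∀ x : M, TangentSpace (𝓡 4) x [⋀^Fin k]→L[ℝ] ℝ} (hα : IsSmoothForm α)
    (hd : ∀ x, dForm α x = 0) (hy : y ∈ (extChartAt (𝓡 4) p).target) :
    extDeriv (formInChart α p) y = 0 := by
  -- `dForm` controls the derivative only at the centre of each preferred chart, so `y` is moved
  -- into the chart centred at the point it represents.
  set x := (extChartAt (𝓡 4) p).symm y
  have hyx : y ∈ transitionSource p x := mem_transitionSource_self hy
  have h1 : formInChart α p =ᶠ[𝓝 y] fun z => (formInChart α x (transition p x z)).compContinuousLinearMap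
      (fderiv ℝ (transition p x) z) := by
    filter_upwards [(isOpen_transitionSource p x).mem_nhds hyx] with z hz
    exact formInChart_transition hz α
  have h2 : DifferentiableAt ℝ (formInChart α x) (transition p x y) :=
    ((hα x).contDiffAt ((isOpen_extChartAt_target x).mem_nhds
      (transition_mem hyx))).differentiableAt (by simp)
  have h3 : extDeriv (formInChart α x) (transition p x y) = 0 := by
    ext v
    exact (dForm_apply α x v).symm.trans (by rw [hd x]; rfl)
  rw [h1.extDeriv_eq, extDeriv_pullback h2 (contDiffAt_transition hyx)
    (by rw [minSmoothness_of_isRCLikeNormedField]; exact ENat.LEInfty.out), h3]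
  rfl

/-- The exterior derivative of a 2-form on a vector space as a cyclic sum. -/
theorem extDeriv_twoForm {α : E4 → E4 [⋀^Fin 2]→L[ℝ] ℝ} {y : E4} (hα : DifferentiableAt ℝ α y)
    (u v w : E4) :
    extDeriv α y ![u, v, w] = fderiv ℝ (fun z => α z ![v, w]) y u +
      fderiv ℝ (fun z => α z ![w, u]) y v + fderiv ℝ (fun z => α z ![u, v]) y w := by
  have e0 : Fin.removeNth 0 ![u, v, w] = ![v, w] := by ext i; fin_cases i <;> rfl
  have e1 : Fin.removeNth 1 ![u, v, w] = ![u, w] := by ext i; fin_cases i <;> rfl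
  have e2 : Fin.removeNth 2 ![u, v, w] = ![u, v] := by ext i; fin_cases i <;> rfl
  have e3 : (fun z => α z ![w, u]) = fun z => -α z ![u, w] :=
    funext fun z => twoForm_swap (α z) w u
  rw [extDeriv_apply hα, Fin.sum_univ_three, e0, e1, e2, e3, fderiv_fun_neg]
  simp

/-- Skew-symmetrization as a continuous linear map. -/
def skewFormL : (E4 →L[ℝ] E4 →L[ℝ] ℝ) →L[ℝ] E4 [⋀^Fin 2]→L[ℝ] ℝ :=
  LinearMap.toContinuousLinearMap
    { toFun := skewForm
      map_add' := fun A B => twoForm_ext fun v w => by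
        rw [ContinuousAlternatingMap.add_apply, skewForm_apply, skewForm_apply, skewForm_apply]
        simp only [add_apply]
        ring
      map_smul' := fun c A => twoForm_ext fun v w => by
        rw [RingHom.id_apply, ContinuousAlternatingMap.smul_apply, skewForm_apply, skewForm_apply]
        simp only [smul_apply, smul_eq_mul]
        ring }

theorem ContDiffAt.skewForm {B : E4 → E4 →L[ℝ] E4 →L[ℝ] ℝ} {y : E4} (hB : ContDiffAt ℝ ∞ B y) :
    ContDiffAt ℝ ∞ (fun z => skewForm (B z)) y :=
  skewFormL.contDiff.contDiffAt.comp y hB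

end Transition

/-! ### Chart independence of the Ricci tensor. -/

section RicciInChart

variable {M : Type*} [TopologicalSpace M] [ChartedSpace E4 M] [IsManifold (𝓡 4) ∞ M]
  [RiemannianBundle (fun x : M => TangentSpace (𝓡 4) x)]
  [IsContMDiffRiemannianBundle (𝓡 4) ∞ E4 (fun x : M => TangentSpace (𝓡 4) x)]

theorem isLocalIsometryOn_transition (p q : M) :
    IsLocalIsometryOn (metricInChart p) (metricInChart q) (transition p q)
      (extChartAt (𝓡 4) p).target (extChartAt (𝓡 4) q).target (transitionSource p q) where
  source := isMetricOn_metricInChart p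
  target := isMetricOn_metricInChart q
  isOpen := isOpen_transitionSource p q
  subset := Set.inter_subset_left
  mapsTo := fun _ hy => transition_mem hy
  smooth := fun _ hy => (contDiffAt_transition hy).contDiffWithinAt
  isometry := fun y hy u v => by
    have key : ∀ {x z : M} (_ : x = z) (a b : E4),
        innerSL ℝ (E := TangentSpace (𝓡 4) x) a b = innerSL ℝ (E := TangentSpace (𝓡 4) z) a b := by
      rintro x _ rfl a b
      rfl
    have h1 := key (symm_transition hy).symm (chartSymmDeriv p y u) (chartSymmDeriv p y v)
    refine h1.trans ?_
    rw [chartSymmDeriv_transition hy u, chartSymmDeriv_transition hy v]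
    rfl

/-- The Ricci tensor is given in every chart by the local formula. -/
theorem ricci_chartSymmDeriv {p : M} {y : E4} (hy : y ∈ (extChartAt (𝓡 4) p).target) (u v : E4) :
    ricci ((extChartAt (𝓡 4) p).symm y) (chartSymmDeriv p y u) (chartSymmDeriv p y v) =
      localRicci (metricInChart p) y u v := by
  have hyx := mem_transitionSource_self hy
  rw [(isLocalIsometryOn_transition p ((extChartAt (𝓡 4) p).symm y)).ricci_eq hyx,
    fderiv_transition hyx]
  rfl

end RicciInChart

/-! ## Kähler structures in charts -/

section KahlerInChart

set_option linter.unusedSectionVars false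

variable {M : Type*} [TopologicalSpace M] [ChartedSpace E4 M] [IsManifold (𝓡 4) ∞ M]
  [RiemannianBundle (fun x : M => TangentSpace (𝓡 4) x)]
  [IsContMDiffRiemannianBundle (𝓡 4) ∞ E4 (fun x : M => TangentSpace (𝓡 4) x)]

/-- An endomorphism field in the preferred chart around `p`. -/
def endInChart (J : ∀ x : M, TangentSpace (𝓡 4) x →L[ℝ] TangentSpace (𝓡 4) x) (p : M) (y : E4) :
    E4 →L[ℝ] E4 :=
  chartDerivAt p y ∘L J ((extChartAt (𝓡 4) p).symm y) ∘L chartSymmDeriv p y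

variable {J : ∀ x : M, TangentSpace (𝓡 4) x →L[ℝ] TangentSpace (𝓡 4) x} {p : M} {y : E4}

theorem chartSymmDeriv_endInChart (hy : y ∈ (extChartAt (𝓡 4) p).target) (u : E4) :
    chartSymmDeriv p y (endInChart J p y u) =
      J ((extChartAt (𝓡 4) p).symm y) (chartSymmDeriv p y u) :=
  chartSymmDeriv_chartDerivAt hy _

theorem endInChart_chartDerivAt (hy : y ∈ (extChartAt (𝓡 4) p).target)
    (u : TangentSpace (𝓡 4) ((extChartAt (𝓡 4) p).symm y)) :
    endInChart J p y (chartDerivAt p y u) =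
      chartDerivAt p y (J ((extChartAt (𝓡 4) p).symm y) u) := by
  change chartDerivAt p y (J _ (chartSymmDeriv p y (chartDerivAt p y u))) = _
  rw [chartSymmDeriv_chartDerivAt hy]

theorem formInChart_kahlerForm (hy : y ∈ (extChartAt (𝓡 4) p).target) :
    formInChart (kahlerForm J) p y = skewForm (metricInChart p y ∘L endInChart J p y) := by
  refine twoForm_ext fun u v => ?_
  rw [skewForm_apply]
  simp only [ContinuousLinearMap.comp_apply, metricInChart_apply, chartSymmDeriv_endInChart hy]
  rfl

theorem formInChart_ricciForm (hy : y ∈ (extChartAt (𝓡 4) p).target) :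
    formInChart (ricciForm J) p y =
      skewForm (localRicci (metricInChart p) y ∘L endInChart J p y) := by
  refine twoForm_ext fun u v => ?_
  rw [skewForm_apply]
  simp only [ContinuousLinearMap.comp_apply, ← ricci_chartSymmDeriv hy,
    chartSymmDeriv_endInChart hy]
  rfl

/-- Lie brackets of vector fields in a chart. -/
theorem chartDerivAt_mlieBracket {V W : ∀ x : M, TangentSpace (𝓡 4) x} {V' W' : E4 → E4}
    (hy : y ∈ (extChartAt (𝓡 4) p).target)
    (hV : ContMDiffAt (𝓡 4) ((𝓡 4).prod 𝓘(ℝ, E4)) ∞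
      (fun y => (⟨y, V y⟩ : TangentBundle (𝓡 4) M)) ((extChartAt (𝓡 4) p).symm y))
    (hW : ContMDiffAt (𝓡 4) ((𝓡 4).prod 𝓘(ℝ, E4)) ∞
      (fun y => (⟨y, W y⟩ : TangentBundle (𝓡 4) M)) ((extChartAt (𝓡 4) p).symm y))
    (hV' : ∀ z ∈ (extChartAt (𝓡 4) p).target,
      V ((extChartAt (𝓡 4) p).symm z) = chartSymmDeriv p z (V' z))
    (hW' : ∀ z ∈ (extChartAt (𝓡 4) p).target,
      W ((extChartAt (𝓡 4) p).symm z) = chartSymmDeriv p z (W' z)) :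
    chartDerivAt p y (VectorField.mlieBracket (𝓡 4) V W ((extChartAt (𝓡 4) p).symm y)) =
      fderiv ℝ W' y (V' y) - fderiv ℝ V' y (W' y) := by
  have : IsManifold (𝓡 4) (minSmoothness ℝ 2) M := by
    rw [minSmoothness_of_isRCLikeNormedField]
    infer_instance
  have h1 := VectorField.mpullback_mlieBracket (I := 𝓘(ℝ, E4)) (I' := 𝓡 4) (n := ∞)
    (f := (extChartAt (𝓡 4) p).symm) (x₀ := y)
    (hV.mdifferentiableAt (by simp)) (hW.mdifferentiableAt (by simp))
    (contMDiffAt_extChartAt_symm hy)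
    (by rw [minSmoothness_of_isRCLikeNormedField]; exact ENat.LEInfty.out)
  have pull : ∀ {X : ∀ x : M, TangentSpace (𝓡 4) x} {X' : E4 → E4},
      (∀ z ∈ (extChartAt (𝓡 4) p).target,
        X ((extChartAt (𝓡 4) p).symm z) = chartSymmDeriv p z (X' z)) →
      VectorField.mpullback 𝓘(ℝ, E4) (𝓡 4) (extChartAt (𝓡 4) p).symm X =ᶠ[𝓝 y] X' := by
    intro X X' hX
    filter_upwards [(isOpen_extChartAt_target p).mem_nhds hy] with z hz
    change (chartSymmDeriv p z).inverse _ = _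
    rw [hX z hz, chartSymmDeriv_inverse hz, chartDerivAt_chartSymmDeriv hz]
  rw [(pull hV').mlieBracket_vectorField_eq (pull hW')] at h1
  have h2 : VectorField.mlieBracket 𝓘(ℝ, E4) V' W' y = VectorField.lieBracket ℝ V' W' y := by
    have h3 : VectorField.mlieBracketWithin 𝓘(ℝ, E4) V' W' Set.univ y =
        VectorField.lieBracketWithin ℝ V' W' Set.univ y :=
      congrFun VectorField.mlieBracketWithin_eq_lieBracketWithin y
    rw [VectorField.lieBracketWithin_univ] at h3
    exact (congrFun VectorField.mlieBracketWithin_univ y).symm.trans h3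
  rw [← chartSymmDeriv_inverse hy]
  exact h1.trans h2

namespace IsKahler

variable (hJ : IsKahler J)

include hJ

theorem contMDiffAt_apply {V : ∀ x : M, TangentSpace (𝓡 4) x} {x : M}
    (hV : ContMDiffAt (𝓡 4) ((𝓡 4).prod 𝓘(ℝ, E4)) ∞
      (fun y => (⟨y, V y⟩ : TangentBundle (𝓡 4) M)) x) :
    ContMDiffAt (𝓡 4) ((𝓡 4).prod 𝓘(ℝ, E4)) ∞
      (fun y => (⟨y, J y (V y)⟩ : TangentBundle (𝓡 4) M)) x :=
  ContMDiffAt.clm_bundle_apply (b := fun x : M => x) (F₁ := E4) (F₂ := E4)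
    (E₁ := fun x : M => TangentSpace (𝓡 4) x) (E₂ := fun x : M => TangentSpace (𝓡 4) x)
    (hJ.smooth x) hV

theorem contDiffOn_metric_comp_endInChart :
    ContDiffOn ℝ ∞ (fun z => metricInChart p z ∘L endInChart J p z)
      (extChartAt (𝓡 4) p).target := by
  refine contDiffOn_bilin fun u v y hy => ContDiffAt.contDiffWithinAt ?_
  have hs := (extChartAt (𝓡 4) p).map_target hy
  refine (contDiffAt_inner_vectorField hy (hJ.contMDiffAt_apply (contMDiffAt_coordField hs u))
    (contMDiffAt_coordField hs v)).congr_of_eventuallyEq ?_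
  filter_upwards [(isOpen_extChartAt_target p).mem_nhds hy] with z hz
  rw [coordField_symm hz, coordField_symm hz, ContinuousLinearMap.comp_apply, metricInChart_apply,
    chartSymmDeriv_endInChart hz]

/-- `J` is recovered from the smooth bilinear form `g(J·, ·)` by raising an index with the smooth
inverse metric. -/
theorem contDiffAt_endInChart (hy : y ∈ (extChartAt (𝓡 4) p).target) :
    ContDiffAt ℝ ∞ (endInChart J p) y := by
  have hm := isMetricOn_metricInChart p
  refine ((hm.contDiffAt_inverse hy).clm_comp
    (hJ.contDiffOn_metric_comp_endInChart.contDiffAt (hm.isOpen.mem_nhds hy))).congr_of_eventuallyEq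
    ?_
  filter_upwards [hm.isOpen.mem_nhds hy] with z hz
  ext1 u
  exact ((hm.isInvertible hz).inverse_apply_eq.2 rfl).symm

theorem isSmoothForm_kahlerForm : IsSmoothForm (kahlerForm J) := fun p y hy => by
  have hm := isMetricOn_metricInChart p
  refine (ContDiffAt.congr_of_eventuallyEq
    ((hm.contDiffAt hy).clm_comp (hJ.contDiffAt_endInChart hy)).skewForm ?_).contDiffWithinAt
  filter_upwards [hm.isOpen.mem_nhds hy] with z hz
  exact formInChart_kahlerForm hz

theorem isSmoothForm_ricciForm : IsSmoothForm (ricciForm J) := fun p y hy => by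
  have hm := isMetricOn_metricInChart p
  refine (ContDiffAt.congr_of_eventuallyEq
    ((hm.contDiffAt_ricci hy).clm_comp (hJ.contDiffAt_endInChart hy)).skewForm ?_).contDiffWithinAt
  filter_upwards [hm.isOpen.mem_nhds hy] with z hz
  exact formInChart_ricciForm hz

theorem endInChart_sq (hy : y ∈ (extChartAt (𝓡 4) p).target) (v : E4) :
    endInChart J p y (endInChart J p y v) = -v := by
  change endInChart J p y (chartDerivAt p y (J _ (chartSymmDeriv p y v))) = _
  rw [endInChart_chartDerivAt hy, hJ.sq_eq_neg, map_neg, chartDerivAt_chartSymmDeriv hy]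

theorem metricInChart_hermitian (hy : y ∈ (extChartAt (𝓡 4) p).target) (v w : E4) :
    metricInChart p y (endInChart J p y v) (endInChart J p y w) = metricInChart p y v w := by
  rw [metricInChart_apply, metricInChart_apply, chartSymmDeriv_endInChart hy,
    chartSymmDeriv_endInChart hy, hJ.hermitian]

theorem kahlerForm_apply (x : M) (v w : TangentSpace (𝓡 4) x) :
    kahlerForm J x ![v, w] = inner ℝ (J x v) w :=
  kahlerBilin_apply (hJ.sq_eq_neg x) (hJ.hermitian x) v w

theorem formInChart_kahlerForm_apply (hy : y ∈ (extChartAt (𝓡 4) p).target) (u v : E4) :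
    formInChart (kahlerForm J) p y ![u, v] = metricInChart p y (endInChart J p y u) v := by
  have h : formInChart (kahlerForm J) p y ![u, v] =
      kahlerForm J _ ![chartSymmDeriv p y u, chartSymmDeriv p y v] :=
    twoForm_eta (kahlerForm J ((extChartAt (𝓡 4) p).symm y)) fun i => chartSymmDeriv p y (![u, v] i)
  rw [h, hJ.kahlerForm_apply, metricInChart_apply, chartSymmDeriv_endInChart hy]

theorem kahlerForm_closed_inChart (hy : y ∈ (extChartAt (𝓡 4) p).target) (u v w : E4) :
    (fderiv ℝ (metricInChart p) y u (endInChart J p y v) w +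
      metricInChart p y (fderiv ℝ (endInChart J p) y u v) w) +
    (fderiv ℝ (metricInChart p) y v (endInChart J p y w) u +
      metricInChart p y (fderiv ℝ (endInChart J p) y v w) u) +
    (fderiv ℝ (metricInChart p) y w (endInChart J p y u) v +
      metricInChart p y (fderiv ℝ (endInChart J p) y w u) v) = 0 := by
  have hm := isMetricOn_metricInChart p
  have hd : DifferentiableAt ℝ (formInChart (kahlerForm J) p) y :=
    ((hJ.isSmoothForm_kahlerForm p).contDiffAt (hm.isOpen.mem_nhds hy)).differentiableAt (by simp)
  have h0 : ∀ a b c : E4, fderiv ℝ (fun z => formInChart (kahlerForm J) p z ![b, c]) y a =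
      fderiv ℝ (metricInChart p) y a (endInChart J p y b) c +
        metricInChart p y (fderiv ℝ (endInChart J p) y a b) c := by
    intro a b c
    have h1 : (fun z => formInChart (kahlerForm J) p z ![b, c]) =ᶠ[𝓝 y]
        fun z => metricInChart p z (endInChart J p z b) c := by
      filter_upwards [hm.isOpen.mem_nhds hy] with z hz
      exact hJ.formInChart_kahlerForm_apply hz b c
    have h2 := ((hm.contDiffAt hy).hasFDerivAt_top.clm_apply
      ((hJ.contDiffAt_endInChart hy).hasFDerivAt_top.clm_apply (hasFDerivAt_const b y))).clm_apply
      (hasFDerivAt_const c y)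
    rw [h1.fderiv_eq, h2.fderiv]
    simp
    ring
  rw [← h0, ← h0, ← h0, ← extDeriv_twoForm hd,
    extDeriv_formInChart_eq_zero hJ.isSmoothForm_kahlerForm hJ.closed hy]
  rfl

/-- Integrability is evaluated on coordinate fields: their own bracket vanishes, and the other three
brackets involve only first derivatives of `J`. -/
theorem nijenhuis_inChart (hy : y ∈ (extChartAt (𝓡 4) p).target) (u v : E4) :
    fderiv ℝ (endInChart J p) y (endInChart J p y u) v -
      fderiv ℝ (endInChart J p) y (endInChart J p y v) u +
      endInChart J p y (fderiv ℝ (endInChart J p) y v u) -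
      endInChart J p y (fderiv ℝ (endInChart J p) y u v) = 0 := by
  have hs := (extChartAt (𝓡 4) p).map_target hy
  have c : ∀ a, ContMDiffAt (𝓡 4) ((𝓡 4).prod 𝓘(ℝ, E4)) ∞
      (fun y => (⟨y, coordField p a y⟩ : TangentBundle (𝓡 4) M))
      ((extChartAt (𝓡 4) p).symm y) := fun a => contMDiffAt_coordField hs a
  have cJ := fun a => hJ.contMDiffAt_apply (c a)
  have e : ∀ a : E4, ∀ z ∈ (extChartAt (𝓡 4) p).target,
      coordField p a ((extChartAt (𝓡 4) p).symm z) = chartSymmDeriv p z ((fun _ => a) z) :=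
    fun a z hz => coordField_symm hz a
  have eJ : ∀ a : E4, ∀ z ∈ (extChartAt (𝓡 4) p).target,
      J _ (coordField p a ((extChartAt (𝓡 4) p).symm z)) =
        chartSymmDeriv p z ((fun z => endInChart J p z a) z) := fun a z hz => by
    rw [coordField_symm hz, chartSymmDeriv_endInChart hz]
  have d : ∀ a b : E4, fderiv ℝ (fun z => endInChart J p z a) y b =
      fderiv ℝ (endInChart J p) y b a := fun a b => by
    have := (hJ.contDiffAt_endInChart hy).hasFDerivAt_top.clm_apply (hasFDerivAt_const a y)
    rw [this.fderiv]
    simp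
  have h0 := congrArg (chartDerivAt p y) (hJ.integrable (coordField p u) (coordField p v)
    ((extChartAt (𝓡 4) p).symm y) (c u) (c v))
  rw [map_sub, map_sub, map_sub, map_zero, ← endInChart_chartDerivAt hy,
    ← endInChart_chartDerivAt hy, chartDerivAt_mlieBracket hy (cJ u) (cJ v) (eJ u) (eJ v),
    chartDerivAt_mlieBracket hy (cJ u) (c v) (eJ u) (e v),
    chartDerivAt_mlieBracket hy (c u) (cJ v) (e u) (eJ v),
    chartDerivAt_mlieBracket hy (c u) (c v) (e u) (e v)] at h0
  simp only [d, fderiv_fun_const, Pi.zero_apply, zero_apply, zero_sub, sub_zero, map_neg] at h0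
  rw [← h0]
  abel

theorem isKahlerOn_inChart (p : M) :
    IsKahlerOn (metricInChart p) (endInChart J p) (extChartAt (𝓡 4) p).target where
  toIsMetricOn := isMetricOn_metricInChart p
  smoothJ := fun _ hy => (hJ.contDiffAt_endInChart hy).contDiffWithinAt
  sq := fun _ hy => hJ.endInChart_sq hy
  herm := fun _ hy => hJ.metricInChart_hermitian hy
  nijenhuis := fun _ hy => hJ.nijenhuis_inChart hy
  closed := fun _ hy => hJ.kahlerForm_closed_inChart hy

end IsKahler

end KahlerInChart

/-! ## The Einstein-Maxwell equations -/

section Forms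

set_option linter.unusedSectionVars false

variable {M : Type*} [TopologicalSpace M] [ChartedSpace E4 M] [IsManifold (𝓡 4) ∞ M] {k : ℕ}
  {α β : ∀ x : M, TangentSpace (𝓡 4) x [⋀^Fin k]→L[ℝ] ℝ}

theorem IsSmoothForm.linearCombination (hα : IsSmoothForm α) (hβ : IsSmoothForm β) (a b : ℝ) :
    IsSmoothForm fun x => a • α x + b • β x := fun p =>
  ((hα p).const_smul a).add ((hβ p).const_smul b)

theorem IsSmoothForm.differentiableAt (hα : IsSmoothForm α) {p : M} {y : E4}
    (hy : y ∈ (extChartAt (𝓡 4) p).target) : DifferentiableAt ℝ (formInChart α p) y :=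
  ((hα p).contDiffAt ((isOpen_extChartAt_target p).mem_nhds hy)).differentiableAt (by simp)

theorem dForm_linearCombination_eq_zero (hα : IsSmoothForm α) (hβ : IsSmoothForm β)
    (dα : ∀ x, dForm α x = 0) (dβ : ∀ x, dForm β x = 0) (a b : ℝ) (x : M) :
    dForm (fun x => a • α x + b • β x) x = 0 := by
  have hx := mem_extChartAt_target (I := 𝓡 4) x
  have h : extDeriv (formInChart (fun x => a • α x + b • β x) x) (extChartAt (𝓡 4) x x) = 0 := by
    change extDeriv (a • formInChart α x + b • formInChart β x) _ = 0
    rw [extDeriv_add ((hα.differentiableAt hx).const_smul a) ((hβ.differentiableAt hx).const_smul b),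
      extDeriv_smul, extDeriv_smul, extDeriv_formInChart_eq_zero hα dα hx,
      extDeriv_formInChart_eq_zero hβ dβ hx, smul_zero, smul_zero, add_zero]
  rw [dForm, h]
  rfl

/-- A property that holds at all points of the form `(extChartAt p).symm y` holds everywhere. -/
theorem forall_of_chart {P : M → Prop}
    (h : ∀ (p : M) (y : E4), y ∈ (extChartAt (𝓡 4) p).target → P ((extChartAt (𝓡 4) p).symm y))
    (x : M) : P x := by
  have := h x _ (mem_extChartAt_target x)
  rwa [extChartAt_to_inv] at this

end Forms

/-! ### Global symmetries of the Ricci tensor, the Ricci form and the field equations. -/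

section EinsteinMaxwell

set_option linter.unusedSectionVars false

variable {M : Type*} [TopologicalSpace M] [ChartedSpace E4 M] [IsManifold (𝓡 4) ∞ M]
  [RiemannianBundle (fun x : M => TangentSpace (𝓡 4) x)]
  [IsContMDiffRiemannianBundle (𝓡 4) ∞ E4 (fun x : M => TangentSpace (𝓡 4) x)]

theorem ricci_symm (x : M) : ∀ v w : TangentSpace (𝓡 4) x, ricci x v w = ricci x w v :=
  forall_of_chart (P := fun x => ∀ v w : TangentSpace (𝓡 4) x, ricci x v w = ricci x w v)
    (fun p y hy v w => by
      rw [← chartSymmDeriv_chartDerivAt hy v, ← chartSymmDeriv_chartDerivAt hy w,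
        ricci_chartSymmDeriv hy, ricci_chartSymmDeriv hy]
      exact (isMetricOn_metricInChart p).ricci_symm hy _ _) x

namespace IsKahler

variable {J : ∀ x : M, TangentSpace (𝓡 4) x →L[ℝ] TangentSpace (𝓡 4) x} (hJ : IsKahler J)

include hJ

theorem ricci_complex (x : M) :
    ∀ v w : TangentSpace (𝓡 4) x, ricci x (J x v) (J x w) = ricci x v w :=
  forall_of_chart
    (P := fun x => ∀ v w : TangentSpace (𝓡 4) x, ricci x (J x v) (J x w) = ricci x v w)
    (fun p y hy v w => by
      rw [← chartSymmDeriv_chartDerivAt hy v, ← chartSymmDeriv_chartDerivAt hy w,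
        ← chartSymmDeriv_endInChart hy, ← chartSymmDeriv_endInChart hy,
        ricci_chartSymmDeriv hy, ricci_chartSymmDeriv hy]
      exact (hJ.isKahlerOn_inChart p).ricci_complex hy _ _) x

theorem ricciForm_apply (x : M) (v w : TangentSpace (𝓡 4) x) :
    ricciForm J x ![v, w] = ricci x (J x v) w :=
  skewForm_comp_apply (ricci_symm x) (hJ.sq_eq_neg x) (hJ.ricci_complex x) v w

/-- The Ricci form of a Kähler surface is closed. -/
theorem dForm_ricciForm (x : M) : dForm (ricciForm J) x = 0 := by
  have hx := mem_extChartAt_target (I := 𝓡 4) x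
  have hK := hJ.isKahlerOn_inChart x
  set y := extChartAt (𝓡 4) x x
  -- The factor `1 / 2` comes from `skewForm`: the trace of `J R(b, c)` is the difference of the two
  -- Ricci terms that `skewForm` averages.
  have h0 : ∀ a b c : E4, fderiv ℝ (fun z => formInChart (ricciForm J) x z ![b, c]) y a =
      (1 / 2) * traceCLM E4 (fderiv ℝ (endInChart J x) y a * localRiemann (metricInChart x) y b c +
        endInChart J x y * fderiv ℝ (localRiemann (metricInChart x)) y a b c) := by
    intro a b c
    have h1 : (fun z => formInChart (ricciForm J) x z ![b, c]) =ᶠ[𝓝 y] fun z =>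
        (1 / 2) * traceCLM E4 (endInChart J x z * localRiemann (metricInChart x) z b c) := by
      filter_upwards [hK.isOpen.mem_nhds hx] with z hz
      rw [formInChart_ricciForm hz, skewForm_apply, ← hK.ricci_complex_skew hz]
      simp only [ContinuousLinearMap.comp_apply]
      ring
    have h2 := (hJ.contDiffAt_endInChart hx).hasFDerivAt_top.clm_comp
      (((hK.contDiffAt_riemann hx).hasFDerivAt_top.clm_apply (hasFDerivAt_const b y)).clm_apply
        (hasFDerivAt_const c y))
    have h3 := ((traceCLM E4).hasFDerivAt.comp y h2).const_mul (1 / 2 : ℝ)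
    rw [h1.fderiv_eq]
    refine (congrArg (fun L => L a) h3.fderiv).trans ?_
    simp only [smul_apply, ContinuousLinearMap.comp_apply, smul_eq_mul]
    congr 2
    ext1 t
    simp
    abel
  have h : extDeriv (formInChart (ricciForm J) x) y = 0 := by
    ext v
    have hv : v = ![v 0, v 1, v 2] := by
      ext1 i
      fin_cases i <;> rfl
    rw [hv, extDeriv_twoForm (hJ.isSmoothForm_ricciForm.differentiableAt hx), h0, h0, h0]
    have := hK.ricci_closed hx (v 1) (v 2) (v 0)
    change _ = (0 : ℝ)
    linarith
  rw [dForm, h]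
  rfl

theorem hodgeStar_kahlerForm (x : M) :
    hodgeStar (hJ.orientation x) (kahlerForm J x) = kahlerForm J x :=
  _root_.hodgeStar_kahlerForm _ (hJ.orientation_eq x) (hJ.sq_eq_neg x) (hJ.hermitian x)

theorem hodgeStar_primitiveRicciForm (x : M) :
    hodgeStar (hJ.orientation x) (primitiveRicciForm J x) = -primitiveRicciForm J x :=
  hodgeStar_primitive _ (hJ.orientation_eq x) (ricci_symm x) (hJ.sq_eq_neg x) (hJ.hermitian x)
    (hJ.ricci_complex x)

theorem hodgeStar_maxwell (x : M) :
    hodgeStar (hJ.orientation x) (kahlerForm J x + (1 / 2 : ℝ) • primitiveRicciForm J x) =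
      kahlerForm J x - (1 / 2 : ℝ) • primitiveRicciForm J x := by
  rw [hodgeStar_add, hodgeStar_smul, hJ.hodgeStar_kahlerForm, hJ.hodgeStar_primitiveRicciForm,
    smul_neg, sub_eq_add_neg]

theorem selfDualPart_maxwell (x : M) :
    selfDualPart (hJ.orientation x)
      (kahlerForm J x + (1 / 2 : ℝ) • primitiveRicciForm J x) = kahlerForm J x := by
  rw [selfDualPart, hJ.hodgeStar_maxwell]
  module

theorem antiSelfDualPart_maxwell (x : M) :
    antiSelfDualPart (hJ.orientation x)
      (kahlerForm J x + (1 / 2 : ℝ) • primitiveRicciForm J x) =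
        (1 / 2 : ℝ) • primitiveRicciForm J x := by
  rw [antiSelfDualPart, hJ.hodgeStar_maxwell]
  module

theorem isMaxwell (hs : ∀ x y : M, scalarCurvature x = scalarCurvature y) :
    IsMaxwell hJ.orientation
      (fun x => kahlerForm J x + (1 / 2 : ℝ) • primitiveRicciForm J x) := by
  -- `M` may be empty, and then any constant serves.
  obtain ⟨c, hc⟩ : ∃ c : ℝ, ∀ x : M, scalarCurvature x = c := by
    by_cases h : Nonempty M
    · exact ⟨scalarCurvature h.some, fun x => hs x _⟩
    · exact ⟨0, fun x => (h ⟨x⟩).elim⟩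
  -- Here the constancy of `s` enters: with `s = c`, expanding `ω ± (ρ - (c/4)ω)/2` gives constant
  -- coefficients `1 ∓ c/8` and `±1/2` of the closed forms `ω` and `ρ`.
  have hF : (fun x => kahlerForm J x + (1 / 2 : ℝ) • primitiveRicciForm J x) =
      fun x => (1 - c / 8) • kahlerForm J x + (1 / 2 : ℝ) • ricciForm J x := by
    funext x
    rw [primitiveRicciForm, hc]
    module
  have hsF : (fun x => hodgeStar (hJ.orientation x)
      (kahlerForm J x + (1 / 2 : ℝ) • primitiveRicciForm J x)) =
      fun x => (1 + c / 8) • kahlerForm J x + (-1 / 2 : ℝ) • ricciForm J x := by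
    funext x
    rw [hJ.hodgeStar_maxwell, primitiveRicciForm, hc]
    module
  refine ⟨?_, ?_, ?_⟩
  · rw [hF]
    exact hJ.isSmoothForm_kahlerForm.linearCombination hJ.isSmoothForm_ricciForm _ _
  · rw [hF]
    exact dForm_linearCombination_eq_zero hJ.isSmoothForm_kahlerForm hJ.isSmoothForm_ricciForm
      hJ.closed hJ.dForm_ricciForm _ _
  · rw [hsF]
    exact dForm_linearCombination_eq_zero hJ.isSmoothForm_kahlerForm hJ.isSmoothForm_ricciForm
      hJ.closed hJ.dForm_ricciForm _ _

/-- Pointwise and valid for any scalar curvature: by (a) the trace-free part of `F ∘ F` is `2 ω ∘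
(ρ₀/2)`, which `formComp_kahlerForm` identifies with `-[r]₀`. -/
theorem einstein (x : M) (v w : TangentSpace (𝓡 4) x) :
    traceFree (fun v w => ricci x v w +
      formComp (kahlerForm J x + (1 / 2 : ℝ) • primitiveRicciForm J x)
        (kahlerForm J x + (1 / 2 : ℝ) • primitiveRicciForm J x) v w) v w = 0 := by
  have h1 : formComp (kahlerForm J x) (primitiveRicciForm J x) v w =
      -(ricci x v w - scalarCurvature x / 4 * inner ℝ v w) :=
    formComp_kahlerForm (ricci_symm x) (hJ.sq_eq_neg x) (hJ.hermitian x) (hJ.ricci_complex x) _ v w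
  have h2 : formComp (kahlerForm J x) ((1 / 2 : ℝ) • primitiveRicciForm J x) v w =
      1 / 2 * formComp (kahlerForm J x) (primitiveRicciForm J x) v w := by
    simp only [formComp, ContinuousAlternatingMap.smul_apply, smul_eq_mul, Finset.mul_sum]
    exact Finset.sum_congr rfl fun _ _ => by ring
  have h3 : traceFree (fun v w => ricci x v w) v w =
      ricci x v w - scalarCurvature x / 4 * inner ℝ v w := by
    have h4 : finrank ℝ (TangentSpace (𝓡 4) x) = 4 := Fact.out
    rw [traceFree_apply, h4]
    rfl
  rw [traceFree_add, traceFree_formComp_self (hJ.orientation x), hJ.selfDualPart_maxwell,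
    hJ.antiSelfDualPart_maxwell, h2, h1, h3]
  ring

end IsKahler

end EinsteinMaxwell

end

/-- On an oriented Riemannian 4-manifold every 2-form satisfies `[F ∘ F]₀ = 2 F⁺ ∘ F⁻`.
For a Kähler surface of constant scalar curvature, the 2-form `F = ω + (ρ - (s/4)ω)/2`, whose
self-dual and anti-self-dual parts are `ω` and `(ρ - (s/4)ω)/2`, is closed and co-closed and,
together with the metric, solves the Einstein-Maxwell equations. -/
theorem mainTheorem5 {M : Type*} [TopologicalSpace M] [ChartedSpace E4 M]
    [IsManifold (𝓡 4) ∞ M]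
    [RiemannianBundle (fun x : M => TangentSpace (𝓡 4) x)]
    [IsContMDiffRiemannianBundle (𝓡 4) ∞ E4 (fun x : M => TangentSpace (𝓡 4) x)] :
    (∀ (x : M) (o : Orientation ℝ (TangentSpace (𝓡 4) x) (Fin 4))
      (F : TangentSpace (𝓡 4) x [⋀^Fin 2]→L[ℝ] ℝ) (v w : TangentSpace (𝓡 4) x),
      traceFree (formComp F F) v w
        = 2 * formComp (selfDualPart o F) (antiSelfDualPart o F) v w) ∧
    ∀ (J : ∀ x : M, TangentSpace (𝓡 4) x →L[ℝ] TangentSpace (𝓡 4) x) (hJ : IsKahler J),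
      (∀ x y : M, scalarCurvature x = scalarCurvature y) →
      (∀ (x : M) (v w : TangentSpace (𝓡 4) x), kahlerForm J x ![v, w] = inner ℝ (J x v) w) ∧
      (∀ (x : M) (v w : TangentSpace (𝓡 4) x), ricciForm J x ![v, w] = ricci x (J x v) w) ∧
      (∀ x : M, selfDualPart (hJ.orientation x)
        (kahlerForm J x + (1 / 2 : ℝ) • primitiveRicciForm J x) = kahlerForm J x) ∧
      (∀ x : M, antiSelfDualPart (hJ.orientation x)
        (kahlerForm J x + (1 / 2 : ℝ) • primitiveRicciForm J x)
          = (1 / 2 : ℝ) • primitiveRicciForm J x) ∧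
      IsMaxwell hJ.orientation
        (fun x => kahlerForm J x + (1 / 2 : ℝ) • primitiveRicciForm J x) ∧
      IsEinsteinMaxwell hJ.orientation
        (fun x => kahlerForm J x + (1 / 2 : ℝ) • primitiveRicciForm J x) :=
  ⟨fun _ o F v w => traceFree_formComp_self o F v w, fun _ hJ hs =>
    ⟨hJ.kahlerForm_apply, hJ.ricciForm_apply, hJ.selfDualPart_maxwell,
      hJ.antiSelfDualPart_maxwell, hJ.isMaxwell hs, hJ.isMaxwell hs, hJ.einstein⟩⟩
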